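/- All simplicial complexes are finite and abstract, $|K|$ denotes the geometric realization of $K$, and $\mathrm{lk}(\sigma,\Delta)=\{\tau\in\Delta:\ \sigma\cap\tau=\emptyset,\ \sigma\cup\tau\in\Delta\}$. A *normal $3$-pseudomanifold* is a simplicial complex, all of whose facets have dimension $3$, in which every $2$-face lies in exactly two facets and in which the links of all faces of codimension at least two (including the empty face, whose link is the whole complex) are connected. A *missing tetrahedron* of $\Delta$ is a set $abuv$ of four vertices with $abuv\notin\Delta$ but $\partial(abuv)\subseteq\Delta$. For a vertex $x$ of such a $\tau=abuv$, $\partial(\tau\setminus\{x\})$ *separates* $\mathrm{lk}(x,\Delta)$ if $|\mathrm{lk}(x,\Delta)|\setminus|\partial(\tau\setminus\{x\})|$ has exactly two connected components. *Edge folding.* Let $\sigma_1,\sigma_2$ be facets of a simplicial complex $\Delta'$ whose intersection is an edge $uv$. A bijection $\psi:\sigma_1\to\sigma_2$ is *edge folding admissible* if $\psi(u)=u$, $\psi(v)=v$, and for every other vertex $y$ of $\sigma_1$ all paths of length at most two from $y$ to $\psi(y)$ in the graph of $\Delta'$ go through $u$ or $v$. In that case, the *edge folding* $(\Delta')^{\psi}_{uv}$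 is the complex obtained from $\Delta'$ by identifying all faces $\rho_1\subseteq\sigma_1$ and $\rho_2\subseteq\sigma_2$ such that $\psi$ restricts to a bijection $\rho_1\to\rho_2$, and then removing the facet that results from identifying $\sigma_1$ and $\sigma_2$. **Lemma.** Let $\Delta$ be a normal $3$-pseudomanifold and let $\tau=abuv$ be a missing tetrahedron of $\Delta$ such that (i) for $x\in\{a,b\}$, $\partial(\tau\setminus\{x\})$ separates $\mathrm{lk}(x,\Delta)$, and (ii) a small neighborhood of $|\partial(abv)|$ in $|\mathrm{lk}(u,\Delta)|$ is a Möbius strip; that is, the closed curve $|\partial(abv)|$ has a neighborhood in $|\mathrm{lk}(u,\Delta)|$ that is homeomorphic to the Möbius strip, with the curve corresponding to the core circle of the strip. Then there exist a normal $3$-pseudomanifold $\Delta'$, an edge $u'v'$ of $\Delta'$, and an edge folding admissible bijection $\psi:\sigma_1\to\sigma_2$ between two facets of $\Delta'$ with $\sigma_1\cap\sigma_2=u'v'$, such that $\Delta$ is isomorphic to the edge folding $(\Delta')^{\psi}_{u'v'}$ through an isomorphism that takes $u'$ to $u$, $v'$ to $v$, and the vertex set of the removed facet to $\{a,b,u,v\}$.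 That is, $\Delta=(\Delta')^{\psi}_{uv}$ is obtained from an edge folding at $uv\in\Delta'$, and $abuv$ is the removed facet. -/

import Mathlib

universe w

/-! ### Simplicial complexes

A finite simplicial complex is a `PreAbstractSimplicialComplex V` on a finite type `V`. Its `faces`
are the nonempty faces; the empty face is always understood to be present in addition. The vertices
are the `x : V` with `{x}` a face. -/

namespace PreAbstractSimplicialComplex

variable {V W : Type*}

/-- The vertex set. -/
def vertexSet (K : PreAbstractSimplicialComplex V) : Set V := {x | {x} ∈ K.faces}

/-- Faces, the empty face included. -/
def IsFace (K : PreAbstractSimplicialComplex V) (σ : Finset V) : Prop := σ = ∅ ∨ σ ∈ K.faces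

/-- Facets: the maximal faces. -/
def IsFacet (K : PreAbstractSimplicialComplex V) (σ : Finset V) : Prop :=
  K.IsFace σ ∧ ∀ τ, K.IsFace τ → σ ⊆ τ → σ = τ

/-- The graph (one-skeleton) of a complex. -/
def graph [DecidableEq V] (K : PreAbstractSimplicialComplex V) : SimpleGraph V where
  Adj x y := x ≠ y ∧ {x, y} ∈ K.faces
  symm := ⟨fun x y h => ⟨h.1.symm, by rw [Finset.pair_comm]; exact h.2⟩⟩
  loopless := ⟨fun _ h => h.1 rfl⟩

/-- The link of `σ`: the (nonempty) `τ` disjoint from `σ` such that `σ ∪ τ` is a face. The link of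
the empty face is the whole complex. -/
def link [DecidableEq V] (K : PreAbstractSimplicialComplex V) (σ : Finset V) :
    PreAbstractSimplicialComplex V where
  faces := {τ | τ.Nonempty ∧ Disjoint σ τ ∧ σ ∪ τ ∈ K.faces}
  isRelLowerSet_faces := by
    intro τ hτ
    refine ⟨hτ.1, fun ρ hρ hne => ⟨hne, hτ.2.1.mono_right hρ, ?_⟩⟩
    exact (K.isRelLowerSet_faces hτ.2.2).2 (Finset.union_subset_union_right hρ)
      (hne.mono Finset.subset_union_right)

/-- The boundary `∂τ` of a simplex: the complex of its proper faces. -/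
def simplexBoundary (τ : Finset V) : PreAbstractSimplicialComplex V where
  faces := {ρ | ρ.Nonempty ∧ ρ ⊂ τ}
  isRelLowerSet_faces := fun _ hρ => ⟨hρ.1, fun _ hπ hne => ⟨hne, lt_of_le_of_lt hπ hρ.2⟩⟩

/-- The geometric realization `|K|`, as a subspace of `V → ℝ`: points of the standard simplex
supported on a face of `K` (barycentric coordinates). -/
def realization [Fintype V] (K : PreAbstractSimplicialComplex V) : Set (V → ℝ) :=
  {x ∈ stdSimplex ℝ V | ∃ s ∈ K.faces, Function.support x ⊆ ↑s}

/-- A `d`-dimensional pseudomanifold: pure of dimension `d`, and each face of codimension one is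
contained in exactly two facets. -/
structure IsPseudomanifold (K : PreAbstractSimplicialComplex V) (d : ℕ) : Prop where
  pure : ∀ σ, K.IsFacet σ → σ.card = d + 1
  ridge : ∀ ρ, K.IsFace ρ → ρ.card = d → {σ | K.IsFacet σ ∧ ρ ⊆ σ}.ncard = 2

/-- A normal `d`-pseudomanifold: the links of all faces of codimension at least two (that is, of
dimension at most `d - 2`, the empty face included) are connected. -/
structure IsNormalPseudomanifold [Fintype V] [DecidableEq V]
    (K : PreAbstractSimplicialComplex V) (d : ℕ) : Prop extends K.IsPseudomanifold d where
  connected_link : ∀ σ, K.IsFace σ → σ.card + 1 ≤ d → IsConnected (K.link σ).realization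

/-- A missing tetrahedron: four vertices which do not span a face, but the boundary of the simplex
they span is contained in the complex. -/
structure IsMissingTetrahedron (K : PreAbstractSimplicialComplex V) (τ : Finset V) : Prop where
  card_eq : τ.card = 4
  notMem : τ ∉ K.faces
  boundary_le : simplexBoundary τ ≤ K

/-- The curve `|∂(xyz)|` separates `|lk w|`: its complement in `|lk w|` has exactly two connected
components. -/
def SeparatesLink [Fintype V] [DecidableEq V] (K : PreAbstractSimplicialComplex V)
    (τ : Finset V) (w : V) : Prop :=
  Nat.card (ConnectedComponents
    ↥((K.link {w}).realization \ (simplexBoundary τ).realization)) = 2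

/-- `L` is isomorphic to `K` through the vertex map `f`. -/
def IsIsoVia [DecidableEq W] (K : PreAbstractSimplicialComplex V)
    (L : PreAbstractSimplicialComplex W) (f : V → W) : Prop :=
  Set.InjOn f K.vertexSet ∧ K.map f = L

end PreAbstractSimplicialComplex

/-! ### The Möbius strip -/

/-- The gluing `(0, t) ∼ (1, -t)` on the rectangle `[0, 1] × [-1, 1]`. -/
def MobiusGlue (p q : ↥(Set.Icc (0 : ℝ) 1 ×ˢ Set.Icc (-1 : ℝ) 1)) : Prop :=
  p.1.1 = 0 ∧ q.1.1 = 1 ∧ q.1.2 = -p.1.2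

/-- The (closed) Möbius strip: the quotient of `[0, 1] × [-1, 1]` by the equivalence relation
generated by `(0, t) ∼ (1, -t)`, with the quotient topology. -/
abbrev MobiusStrip : Type := Quot MobiusGlue

/-- The core circle `{t = 0}` of the Möbius strip. -/
def MobiusStrip.core : Set MobiusStrip := Quot.mk MobiusGlue '' {p | p.1.2 = 0}

/-- A small neighborhood in `S` of the closed curve `C ⊆ S` is a Möbius strip: some neighborhood
`N` of `C` in `S` is homeomorphic to the Möbius strip, with `C` corresponding to the core circle.
(Narrowing the strip around its core yields such neighborhoods that are arbitrarily small.) -/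
def HasMobiusNeighborhood {E : Type*} [TopologicalSpace E] (S C : Set E) : Prop :=
  ∃ N : Set E, N ⊆ S ∧ (∃ U, IsOpen U ∧ C ⊆ U ∧ U ∩ S ⊆ N) ∧
    ∃ e : N ≃ₜ MobiusStrip, Subtype.val '' (e ⁻¹' MobiusStrip.core) = C

/-! ### Edge foldings -/

namespace PreAbstractSimplicialComplex

variable {V : Type*} [DecidableEq V]

/-- The bijection `ψ` between the facets `σ₁` and `σ₂`, which meet exactly in the edge `uv`, is edge
folding admissible: it fixes `u` and `v`, and for every other vertex `y` of `σ₁`, each path of length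
at most two from `y` to `ψ y` goes through `u` or `v`. -/
structure EdgeFoldingAdmissible (K : PreAbstractSimplicialComplex V) (u v : V)
    (σ₁ σ₂ : Finset V) (ψ : σ₁ ≃ σ₂) : Prop where
  facet₁ : K.IsFacet σ₁
  facet₂ : K.IsFacet σ₂
  ne : u ≠ v
  inter_eq : σ₁ ∩ σ₂ = {u, v}
  map_u : ∀ h : u ∈ σ₁, (ψ ⟨u, h⟩ : V) = u
  map_v : ∀ h : v ∈ σ₁, (ψ ⟨v, h⟩ : V) = v
  through : ∀ y : σ₁, (y : V) ≠ u → (y : V) ≠ v → ∀ p : K.graph.Walk (y : V) (ψ y : V),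
    p.length ≤ 2 → u ∈ p.support ∨ v ∈ p.support

/-- The identification of each `ψ y ∈ σ₂` with `y ∈ σ₁`, with `y` as the common representative. -/
def foldMap (σ₁ σ₂ : Finset V) (ψ : σ₁ ≃ σ₂) (x : V) : V :=
  if h : x ∈ σ₂ then (ψ.symm ⟨x, h⟩ : V) else x

theorem EdgeFoldingAdmissible.foldMap_eq {K : PreAbstractSimplicialComplex V} {u v : V}
    {σ₁ σ₂ : Finset V} {ψ : σ₁ ≃ σ₂} (hψ : K.EdgeFoldingAdmissible u v σ₁ σ₂ ψ)
    {τ : Finset V} (hτ : τ ∈ (K.map (foldMap σ₁ σ₂ ψ)).faces) (h : σ₁ ⊆ τ) : τ = σ₁ := by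
  obtain ⟨ρ, hρ, rfl⟩ := hτ
  have hρ : ρ ∈ K.faces := hρ
  have h : σ₁ ⊆ ρ.image (foldMap σ₁ σ₂ ψ) := h
  have hmem : ∀ x, x ∈ σ₁ → x ∈ σ₂ → x = u ∨ x = v := by
    intro x h1 h2
    have hx : x ∈ σ₁ ∩ σ₂ := Finset.mem_inter.2 ⟨h1, h2⟩
    simpa [hψ.inter_eq] using hx
  have huI : u ∈ σ₁ ∩ σ₂ := by simp [hψ.inter_eq]
  have hvI : v ∈ σ₁ ∩ σ₂ := by simp [hψ.inter_eq]
  rw [Finset.mem_inter] at huI hvI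
  -- every vertex of `σ₁` or its partner lies in `ρ`
  have lift : ∀ y : σ₁, (y : V) ∈ ρ ∨ (ψ y : V) ∈ ρ := by
    intro y
    obtain ⟨x, hx, hxy⟩ := Finset.mem_image.1 (h y.2)
    unfold foldMap at hxy
    split_ifs at hxy with h2
    · right
      have : ψ.symm ⟨x, h2⟩ = y := Subtype.ext hxy
      rw [← this]
      simpa using hx
    · left
      rwa [← hxy]
  have hu : u ∈ ρ := by
    have := lift ⟨u, huI.1⟩
    rwa [hψ.map_u, or_self] at this
  have hv : v ∈ ρ := by
    have := lift ⟨v, hvI.1⟩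
    rwa [hψ.map_v, or_self] at this
  have hsub : ∀ s ∈ K.faces, ∀ x ∈ s, ∀ y ∈ s, ({x, y} : Finset V) ∈ K.faces := by
    intro s hs x hx y hy
    exact (K.isRelLowerSet_faces hs).2 (by
      intro z hz
      simp only [Finset.mem_insert, Finset.mem_singleton] at hz
      rcases hz with rfl | rfl <;> assumption) ⟨x, by simp⟩
  have hσ₂ : σ₂ ∈ K.faces := by
    rcases hψ.facet₂.1 with h0 | h0
    · simp [h0] at huI
    · exact h0
  have hψne : ∀ z : σ₁, (z : V) ≠ u → (z : V) ≠ v → (ψ z : V) ≠ u ∧ (ψ z : V) ≠ v := by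
    intro z hzu hzv
    constructor
    · intro hz
      apply hzu
      have : ψ z = ψ ⟨u, huI.1⟩ := Subtype.ext (by rw [hz, hψ.map_u])
      exact congrArg Subtype.val (ψ.injective this)
    · intro hz
      apply hzv
      have : ψ z = ψ ⟨v, hvI.1⟩ := Subtype.ext (by rw [hz, hψ.map_v])
      exact congrArg Subtype.val (ψ.injective this)
  have hcase : σ₁ ⊆ ρ ∨ σ₂ ⊆ ρ := by
    by_cases hex : ∃ y : σ₁, (y : V) ≠ u ∧ (y : V) ≠ v ∧ (y : V) ∈ ρ
    · left
      obtain ⟨y, hyu, hyv, hy⟩ := hex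
      have hy2 : (y : V) ∉ σ₂ := fun h2 => (hmem y y.2 h2).elim hyu hyv
      intro z hz
      rcases lift ⟨z, hz⟩ with hzρ | hzρ
      · exact hzρ
      by_contra hzn
      have hzu : z ≠ u := fun e => hzn (e ▸ hu)
      have hzv : z ≠ v := fun e => hzn (e ▸ hv)
      have hne := hψne ⟨z, hz⟩ hzu hzv
      set z' : V := (ψ ⟨z, hz⟩ : V) with hz'
      have hzσ : z' ∈ σ₂ := (ψ ⟨z, hz⟩).2
      have hneψ : z' ≠ (ψ y : V) := by
        intro e
        have : (⟨z, hz⟩ : σ₁) = y := ψ.injective (Subtype.ext e)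
        exact hzn (by rw [← this] at hy; exact hy)
      have a1 : K.graph.Adj (y : V) z' :=
        ⟨fun e => hy2 (e ▸ hzσ), hsub ρ hρ _ hy _ hzρ⟩
      have a2 : K.graph.Adj z' (ψ y : V) := ⟨hneψ, hsub σ₂ hσ₂ _ hzσ _ (ψ y).2⟩
      have hyne := hψne y hyu hyv
      have := hψ.through y hyu hyv (.cons a1 (.cons a2 .nil)) (by simp)
      simp only [SimpleGraph.Walk.support_cons, SimpleGraph.Walk.support_nil, List.mem_cons,
        List.not_mem_nil, or_false] at this
      rcases this with (e | e | e) | (e | e | e)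
      · exact hyu e.symm
      · exact hne.1 e.symm
      · exact hyne.1 e.symm
      · exact hyv e.symm
      · exact hne.2 e.symm
      · exact hyne.2 e.symm
    · right
      push Not at hex
      intro x hx
      obtain ⟨y, hy⟩ := ψ.surjective ⟨x, hx⟩
      have hyx : (ψ y : V) = x := by rw [hy]
      by_cases hyu : (y : V) = u
      · have : y = ⟨u, huI.1⟩ := Subtype.ext hyu
        rw [this, hψ.map_u] at hyx
        exact hyx ▸ hu
      by_cases hyv : (y : V) = v
      · have : y = ⟨v, hvI.1⟩ := Subtype.ext hyv
        rw [this, hψ.map_v] at hyx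
        exact hyx ▸ hv
      rcases lift y with h1 | h1
      · exact absurd h1 (hex y hyu hyv)
      · exact hyx ▸ h1
  refine Finset.Subset.antisymm ?_ h
  intro t ht
  obtain ⟨x, hx, rfl⟩ := Finset.mem_image.1 ht
  unfold foldMap
  split_ifs with h2
  · exact (ψ.symm ⟨x, h2⟩).2
  · rcases hcase with hc | hc
    · rw [hψ.facet₁.2 ρ (Or.inr hρ) hc]; exact hx
    · exact absurd (by rw [hψ.facet₂.2 ρ (Or.inr hρ) hc]; exact hx) h2

/-- The edge folding `K^ψ_{uv}`: identify the faces of `σ₁` and `σ₂` that correspond under `ψ` and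
remove the facet resulting from `σ₁` and `σ₂`. On the chosen representatives the removed facet
is `σ₁`. (By admissibility, identifying the vertices `y` and `ψ y` identifies no other faces.) -/
def edgeFolding (K : PreAbstractSimplicialComplex V) {u v : V} {σ₁ σ₂ : Finset V} {ψ : σ₁ ≃ σ₂}
    (hψ : K.EdgeFoldingAdmissible u v σ₁ σ₂ ψ) : PreAbstractSimplicialComplex V where
  faces := (K.map (foldMap σ₁ σ₂ ψ)).faces \ {σ₁}
  isRelLowerSet_faces := by
    intro τ hτ
    have hl := (K.map (foldMap σ₁ σ₂ ψ)).isRelLowerSet_faces hτ.1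
    refine ⟨hl.1, fun ρ hρ hne => ⟨hl.2 hρ hne, ?_⟩⟩
    rintro rfl
    exact hτ.2 (hψ.foldMap_eq hτ.1 hρ)

end PreAbstractSimplicialComplex

/-! For x = a, b, removing the curve ∂(τ \ x) splits the link of x in two, so every face through x
that does not lie in τ acquires a side, constant along inclusions. Cutting Δ open along ∂τ according
to these sides doubles a and b but neither u nor v. Gluing in one copy of τ on each side gives the
complex `unfolding`, and folding the two copies back together returns Δ.

For this to make sense the sides must be coherent. The link of an edge of τ is a circle, cut into
two arcs by the two other vertices of τ, and sides are constant along an arc. If both cofacets of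
some triangle of τ through x lay on one side, moving around the edges of τ through x would put every
face at x on that side; hence ∂τ is locally two-sided at a and at b (`IsLabel.cofacet_ne`). On faces
through ab both labellings tell the two arcs of the link of ab apart, so they agree after possibly
exchanging the sides at b (`exists_foldLabelling`). A triangle of a copy of τ then has two cofacets:
that copy, and the one old tetrahedron on its side.

For normality, links of faces not over τ are lifted unchanged, and in the link of a face over τ
everything can be walked into a copy of τ. The two copies share u and v, so only the link of uv
could fall apart: the circle lk(uv) is cut at a and b and closed up by two new edges, giving one
circle or two. Two circles would extend the sides at a and b to a two-sided labelling all along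
∂(abv) in lk(u). This is impossible, because a Möbius strip minus its core is connected
(`label_eq_of_mobius`, `linkReach_edge`).

The folding is admissible because the two copies of a lie in no common face, and an edge leaving τ
at a lies on one side only; likewise for b. The topological hypotheses enter the combinatorics
through one fact: the support of a point can only grow under a small perturbation. -/

/-! ### Points of a simplex and their supports -/

section Support

variable {V : Type*} [Fintype V]

/-- The support of a point, as a finset. -/
noncomputable def supp (x : V → ℝ) : Finset V := by
  classical exact Finset.univ.filter (fun i => x i ≠ 0)

@[simp] theorem mem_supp {x : V → ℝ} {i : V} : i ∈ supp x ↔ x i ≠ 0 := by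
  simp [supp]

theorem coe_supp (x : V → ℝ) : (↑(supp x) : Set V) = Function.support x := by
  ext i; simp

theorem supp_nonempty {x : V → ℝ} (hx : x ∈ stdSimplex ℝ V) : (supp x).Nonempty := by
  by_contra h
  rw [Finset.not_nonempty_iff_eq_empty] at h
  have h0 : ∀ i, x i = 0 := by
    intro i
    by_contra hi
    have := mem_supp.2 hi
    simp [h] at this
  have := hx.2
  simp [h0] at this

theorem mem_realization_iff {K : PreAbstractSimplicialComplex V} {x : V → ℝ} :
    x ∈ K.realization ↔ x ∈ stdSimplex ℝ V ∧ supp x ∈ K.faces := by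
  constructor
  · rintro ⟨hx, s, hs, hsub⟩
    refine ⟨hx, (K.isRelLowerSet_faces hs).2 ?_ (supp_nonempty hx)⟩
    rw [← coe_supp] at hsub
    exact_mod_cast hsub
  · rintro ⟨hx, hs⟩
    exact ⟨hx, _, hs, (coe_supp x).ge⟩

theorem isOpen_supp_subset (s : Finset V) : IsOpen {y : V → ℝ | s ⊆ supp y} := by
  have : {y : V → ℝ | s ⊆ supp y} = ⋂ i ∈ s, {y | y i ≠ 0} := by
    ext y; simp [Finset.subset_iff]
  rw [this]
  refine isOpen_biInter_finset fun i _ => ?_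
  exact isOpen_ne_fun (continuous_apply i) continuous_const

/-- On a preconnected set, a property of supports which agrees on comparable supports is constant. -/
theorem IsPreconnected.supp_iff {S : Set (V → ℝ)} (hS : IsPreconnected S) {Q : Finset V → Prop}
    (hQ : ∀ x ∈ S, ∀ y ∈ S, supp x ⊆ supp y → (Q (supp x) ↔ Q (supp y)))
    {x y : V → ℝ} (hx : x ∈ S) (hy : y ∈ S) (h : Q (supp x)) : Q (supp y) := by
  by_contra hn
  -- Nonvanishing of coordinates is an open condition, so both sets are open. A point common to them
  -- has a support lying above a support with `Q` and above one without.
  let U : Set (V → ℝ) := ⋃ z ∈ {z ∈ S | Q (supp z)}, {p | supp z ⊆ supp p}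
  let W : Set (V → ℝ) := ⋃ z ∈ {z ∈ S | ¬ Q (supp z)}, {p | supp z ⊆ supp p}
  obtain ⟨p, hp, hpU, hpW⟩ := hS U W (isOpen_biUnion fun _ _ => isOpen_supp_subset _)
    (isOpen_biUnion fun _ _ => isOpen_supp_subset _)
    (fun z hz => by
      by_cases hq : Q (supp z)
      · exact Or.inl (Set.mem_biUnion (show z ∈ {z ∈ S | Q (supp z)} from ⟨hz, hq⟩)
          (show supp z ⊆ supp z from subset_rfl))
      · exact Or.inr (Set.mem_biUnion (show z ∈ {z ∈ S | ¬ Q (supp z)} from ⟨hz, hq⟩)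
          (show supp z ⊆ supp z from subset_rfl)))
    ⟨x, hx, Set.mem_biUnion (show x ∈ {z ∈ S | Q (supp z)} from ⟨hx, h⟩)
      (show supp x ⊆ supp x from subset_rfl)⟩
    ⟨y, hy, Set.mem_biUnion (show y ∈ {z ∈ S | ¬ Q (supp z)} from ⟨hy, hn⟩)
      (show supp y ⊆ supp y from subset_rfl)⟩
  simp only [U, W, Set.mem_iUnion] at hpU hpW
  obtain ⟨z, hz, hzp⟩ := hpU
  obtain ⟨z', hz', hzp'⟩ := hpW
  exact hz'.2 ((hQ z' hz'.1 p hp hzp').2 ((hQ z hz.1 p hp hzp).1 hz.2))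

theorem supp_combo [DecidableEq V] {x y : V → ℝ} (hx : x ∈ stdSimplex ℝ V) (hy : y ∈ stdSimplex ℝ V)
    {s t : ℝ} (hs : 0 < s) (ht : 0 < t) : supp (s • x + t • y) ⊆ supp x ∪ supp y ∧
      supp x ⊆ supp (s • x + t • y) ∧ supp y ⊆ supp (s • x + t • y) := by
  refine ⟨fun i hi => ?_, fun i hi => ?_, fun i hi => ?_⟩
  · by_contra hn
    simp only [Finset.mem_union, mem_supp, not_or, not_not] at hn
    simp [hn.1, hn.2] at hi
  · have h1 : 0 < x i := lt_of_le_of_ne (hx.1 i) (Ne.symm (mem_supp.1 hi))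
    have h2 := hy.1 i
    rw [mem_supp]
    simp only [Pi.add_apply, Pi.smul_apply, smul_eq_mul]
    positivity
  · have h1 : 0 < y i := lt_of_le_of_ne (hy.1 i) (Ne.symm (mem_supp.1 hi))
    have h2 := hx.1 i
    rw [mem_supp]
    simp only [Pi.add_apply, Pi.smul_apply, smul_eq_mul]
    positivity

/-- Points with comparable supports are joined by a segment. -/
theorem joinedIn_of_supp_subset {S : Set (V → ℝ)} {P : Finset V → Prop}
    (hS : ∀ x, x ∈ S ↔ x ∈ stdSimplex ℝ V ∧ P (supp x)) {x y : V → ℝ}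
    (hx : x ∈ S) (hy : y ∈ S) (h : supp x ⊆ supp y) : JoinedIn S x y := by
  classical
  apply JoinedIn.of_segment_subset
  rintro z ⟨s, t, hs, ht, hst, rfl⟩
  have hx' := (hS x).1 hx
  have hy' := (hS y).1 hy
  rcases hs.eq_or_lt with rfl | hs
  · simp only [zero_add] at hst; subst hst; simpa using hy
  rcases ht.eq_or_lt with rfl | ht
  · simp only [add_zero] at hst; subst hst; simpa using hx
  refine (hS _).2 ⟨convex_stdSimplex ℝ V hx'.1 hy'.1 hs.le ht.le hst, ?_⟩
  obtain ⟨h1, -, h3⟩ := supp_combo hx'.1 hy'.1 hs ht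
  rw [Finset.union_eq_right.2 h] at h1
  rw [h1.antisymm h3]
  exact hy'.2

/-- The barycentre of a nonempty set of vertices. -/
noncomputable def bary (s : Finset V) : V → ℝ := by
  classical exact fun i => if i ∈ s then (s.card : ℝ)⁻¹ else 0

theorem bary_mem {s : Finset V} (hs : s.Nonempty) : bary s ∈ stdSimplex ℝ V := by
  classical
  have : (s.card : ℝ) ≠ 0 := by simpa using hs.ne_empty
  refine ⟨fun i => ?_, ?_⟩
  · unfold bary; split_ifs <;> positivity
  · simp [bary, this]

theorem supp_bary {s : Finset V} : supp (bary s) = s := by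
  classical
  ext i
  simp only [mem_supp, bary]
  constructor
  · intro h; by_contra hn; simp [hn] at h
  · intro h
    have : (s.card : ℝ) ≠ 0 := by simpa using Finset.ne_empty_of_mem h
    simpa [h] using this

end Support

/-! ### Connectedness of realizations in terms of faces -/

namespace PreAbstractSimplicialComplex

theorem mem_of_subset {V : Type*} {K : PreAbstractSimplicialComplex V} {s t : Finset V}
    (hs : s ∈ K.faces) (h : t ⊆ s) (ht : t.Nonempty) : t ∈ K.faces :=
  (K.isRelLowerSet_faces hs).2 h ht

variable {V : Type*} [Fintype V]

/-- Two complementary components of a subcomplex give a two-valued labelling of the remaining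
faces, which is constant along inclusions. -/
theorem exists_label_of_card_components {K L : PreAbstractSimplicialComplex V}
    (h : Nat.card (ConnectedComponents ↥(K.realization \ L.realization)) = 2) :
    ∃ c : Finset V → Bool,
      (∀ F G, F ∈ K.faces → F ∉ L.faces → G ∈ K.faces → G ∉ L.faces → F ⊆ G → c F = c G) ∧
      ∃ F G, F ∈ K.faces ∧ F ∉ L.faces ∧ G ∈ K.faces ∧ G ∉ L.faces ∧ c F ≠ c G := by
  classical
  set S := K.realization \ L.realization with hSdef
  have hS : ∀ p, p ∈ S ↔ p ∈ stdSimplex ℝ V ∧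
      (fun s => s ∈ K.faces ∧ s ∉ L.faces) (supp p) := by
    intro p
    simp only [hSdef, Set.mem_sdiff, mem_realization_iff]
    tauto
  have hmem : ∀ s, s ∈ K.faces → s ∉ L.faces → bary s ∈ S := fun s h1 h2 =>
    (hS _).2 ⟨bary_mem (K.isRelLowerSet_faces h1).1, by rw [supp_bary]; exact ⟨h1, h2⟩⟩
  have hfin : Finite (ConnectedComponents ↥S) := Nat.finite_of_card_ne_zero (by omega)
  let e : ConnectedComponents ↥S ≃ Bool :=
    (Finite.equivFin _).trans ((finCongr h).trans finTwoEquiv)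
  have comp : ∀ p q : S, supp (p : V → ℝ) ⊆ supp (q : V → ℝ) →
      (p : ConnectedComponents S) = q := by
    intro p q hpq
    have := (joinedIn_iff_joined p.2 q.2).1 (joinedIn_of_supp_subset
      (P := fun s => s ∈ K.faces ∧ s ∉ L.faces) hS p.2 q.2 hpq)
    rw [ConnectedComponents.coe_eq_coe']
    exact pathComponent_subset_component q this.symm
  -- A face is labelled by the component of its barycentre; the value `false` elsewhere is never
  -- used.
  let c : Finset V → Bool := fun s => if hs : s ∈ K.faces ∧ s ∉ L.faces then
    e ((⟨bary s, hmem s hs.1 hs.2⟩ : S) : ConnectedComponents S) else false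
  have hc : ∀ s (h1 : s ∈ K.faces) (h2 : s ∉ L.faces),
      c s = e ((⟨bary s, hmem s h1 h2⟩ : S) : ConnectedComponents S) :=
    fun s h1 h2 => dif_pos ⟨h1, h2⟩
  have hsurj : ∀ b, ∃ F, F ∈ K.faces ∧ F ∉ L.faces ∧ c F = b := by
    intro b
    obtain ⟨p, hp⟩ := ConnectedComponents.surjective_coe (e.symm b)
    have hpS := ((hS p).1 p.2).2
    refine ⟨supp (p : V → ℝ), hpS.1, hpS.2, ?_⟩
    rw [hc _ hpS.1 hpS.2, comp ⟨bary (supp (p : V → ℝ)), hmem _ hpS.1 hpS.2⟩ p (by simp [supp_bary]), hp]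
    simp
  refine ⟨c, ?_, ?_⟩
  · intro F G h1 h2 h3 h4 hFG
    rw [hc F h1 h2, hc G h3 h4,
      comp ⟨bary F, hmem F h1 h2⟩ ⟨bary G, hmem G h3 h4⟩ (by simpa [supp_bary] using hFG)]
  · obtain ⟨F, h1, h2, h3⟩ := hsurj true
    obtain ⟨G, h4, h5, h6⟩ := hsurj false
    exact ⟨F, G, h1, h2, h4, h5, by simp [h3, h6]⟩

variable [DecidableEq V]

/-- A connected complex has a connected graph. -/
theorem reflTransGen_of_isConnected {K : PreAbstractSimplicialComplex V}
    (hK : IsConnected K.realization) {x y : V} (hx : {x} ∈ K.faces) (hy : {y} ∈ K.faces) :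
    Relation.ReflTransGen (fun p q => {p, q} ∈ K.faces) x y := by
  classical
  have hmem : ∀ s ∈ K.faces, bary s ∈ K.realization := fun s hs =>
    mem_realization_iff.2 ⟨bary_mem (K.isRelLowerSet_faces hs).1, by rwa [supp_bary]⟩
  -- The property of a support is to contain a vertex reachable from `x`. It also passes down from a
  -- larger support, since all vertices of a face are adjacent to each other.
  have key := hK.isPreconnected.supp_iff
    (Q := fun s => ∃ z ∈ s, Relation.ReflTransGen (fun p q => {p, q} ∈ K.faces) x z)
    (fun p hp q hq hpq => by
      constructor
      · rintro ⟨z, hz, h⟩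
        exact ⟨z, hpq hz, h⟩
      · rintro ⟨z, hz, h⟩
        obtain ⟨r, hr⟩ := supp_nonempty (mem_realization_iff.1 hp).1
        refine ⟨r, hr, h.tail (mem_of_subset (mem_realization_iff.1 hq).2 ?_ (by simp))⟩
        intro i hi
        simp only [Finset.mem_insert, Finset.mem_singleton] at hi
        rcases hi with rfl | rfl
        · exact hz
        · exact hpq hr)
    (hmem _ hx) (hmem _ hy) ⟨x, by simp [supp_bary], .refl⟩
  simpa [supp_bary] using key

/-- A complex whose graph is connected is connected. -/
theorem isConnected_of_reflTransGen {K : PreAbstractSimplicialComplex V} (x : V)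
    (hx : {x} ∈ K.faces)
    (h : ∀ y, {y} ∈ K.faces → Relation.ReflTransGen (fun p q => {p, q} ∈ K.faces) x y) :
    IsConnected K.realization := by
  classical
  have hS : ∀ p, p ∈ K.realization ↔ p ∈ stdSimplex ℝ V ∧ (fun s => s ∈ K.faces) (supp p) :=
    fun p => mem_realization_iff
  have hmem : ∀ s ∈ K.faces, bary s ∈ K.realization := fun s hs =>
    mem_realization_iff.2 ⟨bary_mem (K.isRelLowerSet_faces hs).1, by rwa [supp_bary]⟩
  have hv : ∀ y, {y} ∈ K.faces → JoinedIn K.realization (bary {x}) (bary {y}) := by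
    intro y hy
    have := h y hy
    clear hy
    induction this with
    | refl => exact JoinedIn.refl (hmem _ hx)
    | @tail p q _ hpq ih =>
      have hp : {p} ∈ K.faces := mem_of_subset hpq (by simp) (by simp)
      have hq : {q} ∈ K.faces := mem_of_subset hpq (by simp) (by simp)
      refine ih.trans ?_
      refine (joinedIn_of_supp_subset hS (hmem _ hp) (hmem _ hpq) ?_).trans
        (joinedIn_of_supp_subset hS (hmem _ hq) (hmem _ hpq) ?_).symm
      · simp [supp_bary]
      · simp [supp_bary]
  refine IsPathConnected.isConnected ⟨bary {x}, hmem _ hx, fun {p} hp => ?_⟩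
  obtain ⟨i, hi⟩ := supp_nonempty (mem_realization_iff.1 hp).1
  have hi' : {i} ∈ K.faces := mem_of_subset (mem_realization_iff.1 hp).2 (by simpa using hi) (by simp)
  exact (hv i hi').trans (joinedIn_of_supp_subset hS (hmem _ hi') hp (by
    rw [supp_bary]; simpa using hi))

end PreAbstractSimplicialComplex

/-! ### Narrow strips around the core of the Möbius strip -/

namespace MobiusStrip

/-- The distance to the core. -/
noncomputable def height : MobiusStrip → ℝ :=
  Quot.lift (fun p => |p.1.2|) fun p q h => by
    rw [h.2.2, abs_neg]

theorem continuous_height : Continuous height :=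
  continuous_quot_lift _ (by fun_prop)

theorem core_eq : core = {m | height m = 0} := by
  ext m
  constructor
  · rintro ⟨p, hp, rfl⟩
    exact abs_eq_zero.2 hp
  · induction m using Quot.ind with
    | mk p => exact fun h => ⟨p, abs_eq_zero.1 h, rfl⟩

theorem height_nonneg (m : MobiusStrip) : 0 ≤ height m := by
  induction m using Quot.ind with
  | mk p => exact abs_nonneg _

instance : CompactSpace ↥(Set.Icc (0 : ℝ) 1 ×ˢ Set.Icc (-1 : ℝ) 1) :=
  isCompact_iff_compactSpace.1 (isCompact_Icc.prod isCompact_Icc)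

/-- By compactness of the strip, the height attains a minimum on the complement of `O`, and this
minimum is positive because the core lies in `O`. -/
theorem exists_height_lt_subset {O : Set MobiusStrip} (hO : IsOpen O) (h : core ⊆ O) :
    ∃ ε > 0, {m | height m < ε} ⊆ O := by
  rcases Oᶜ.eq_empty_or_nonempty with he | hne
  · exact ⟨1, one_pos, fun m _ => by simpa using (Set.ext_iff.1 he m)⟩
  obtain ⟨m, hm, hmin⟩ := hO.isClosed_compl.isCompact.exists_isMinOn hne
    continuous_height.continuousOn
  refine ⟨height m, (height_nonneg m).lt_of_ne fun h0 => hm (h (by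
    rw [core_eq]; exact h0.symm)), fun q hq => ?_⟩
  by_contra hqO
  exact absurd (isMinOn_iff.1 hmin q hqO) (not_le.2 hq)

/-- The set is the image of the two convex half-strips t > 0 and t < 0, and the gluing (0, t) ∼ (1,
-t) makes these images meet. This is the one place where the twist is used. -/
theorem isPreconnected_height {ε : ℝ} (hε : 0 < ε) :
    IsPreconnected {m | 0 < height m ∧ height m < ε} := by
  have aux : ∀ I : Set ℝ, Convex ℝ I → IsPreconnected (Quot.mk MobiusGlue '' {p | p.1.2 ∈ I}) := by
    intro I hI
    refine IsPreconnected.image ?_ _ continuous_quot_mk.continuousOn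
    rw [← Topology.IsInducing.subtypeVal.isPreconnected_image]
    have : (Subtype.val '' {p : ↥(Set.Icc (0 : ℝ) 1 ×ˢ Set.Icc (-1 : ℝ) 1) | p.1.2 ∈ I}) =
        Set.Icc (0 : ℝ) 1 ×ˢ (Set.Icc (-1 : ℝ) 1 ∩ I) := by
      ext ⟨s, t⟩
      simp only [Set.mem_image, Set.mem_ofPred_eq, Subtype.exists, Set.mem_prod, Set.mem_inter_iff]
      constructor
      · rintro ⟨_, h, h', rfl⟩
        exact ⟨h.1, h.2, h'⟩
      · rintro ⟨h1, h2, h3⟩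
        exact ⟨(s, t), ⟨h1, h2⟩, h3, rfl⟩
    rw [this]
    exact ((convex_Icc _ _).prod ((convex_Icc _ _).inter hI)).isPreconnected
  have h1 := aux (Set.Ioo 0 ε) (convex_Ioo _ _)
  have h2 := aux (Set.Ioo (-ε) 0) (convex_Ioo _ _)
  -- A height below `ε` that still lies in the strip; the points (0, t) and (1, -t) are glued.
  have ht : 0 < min (ε / 2) 1 := lt_min (by positivity) one_pos
  have ht1 : min (ε / 2) 1 ≤ 1 := min_le_right _ _
  have ht2 : min (ε / 2) 1 < ε := (min_le_left _ _).trans_lt (by linarith)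
  set t := min (ε / 2) 1
  let p : ↥(Set.Icc (0 : ℝ) 1 ×ˢ Set.Icc (-1 : ℝ) 1) :=
    ⟨(0, t), ⟨by simp, by change -1 ≤ t; linarith, ht1⟩⟩
  let q : ↥(Set.Icc (0 : ℝ) 1 ×ˢ Set.Icc (-1 : ℝ) 1) :=
    ⟨(1, -t), ⟨by simp, by change -1 ≤ -t; linarith, by change -t ≤ 1; linarith⟩⟩
  have hpq : Quot.mk MobiusGlue p = Quot.mk MobiusGlue q := Quot.sound ⟨rfl, rfl, rfl⟩
  have hp : p.1.2 ∈ Set.Ioo 0 ε := ⟨ht, ht2⟩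
  have hq : q.1.2 ∈ Set.Ioo (-ε) 0 := ⟨by simp only [q]; linarith, by simp only [q]; linarith⟩
  have hm1 : Quot.mk MobiusGlue p ∈ Quot.mk MobiusGlue '' {p | p.1.2 ∈ Set.Ioo 0 ε} := ⟨p, hp, rfl⟩
  have hm2 : Quot.mk MobiusGlue p ∈ Quot.mk MobiusGlue '' {p | p.1.2 ∈ Set.Ioo (-ε) 0} :=
    ⟨q, hq, hpq.symm⟩
  have := IsPreconnected.union _ hm1 hm2 h1 h2
  convert this using 1
  ext m
  induction m using Quot.ind with
  | mk r =>
  constructor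
  · rintro ⟨ha, hb⟩
    change 0 < |r.1.2| at ha
    change |r.1.2| < ε at hb
    rw [abs_lt] at hb
    rcases lt_or_gt_of_ne (abs_pos.1 ha) with hr | hr
    · exact Or.inr ⟨r, ⟨hb.1, hr⟩, rfl⟩
    · exact Or.inl ⟨r, ⟨hr, hb.2⟩, rfl⟩
  · rintro (⟨s, hs, hsr⟩ | ⟨s, hs, hsr⟩)
    · rw [← hsr]
      change 0 < |s.1.2| ∧ |s.1.2| < ε
      rw [abs_of_pos hs.1]; exact hs
    · rw [← hsr]
      change 0 < |s.1.2| ∧ |s.1.2| < ε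
      rw [abs_of_neg hs.2]; exact ⟨by linarith [hs.2], by linarith [hs.1]⟩

end MobiusStrip

/-- A curve with a Möbius neighbourhood is one-sided: all small neighbourhoods of it contain one
whose complement of the curve is preconnected. -/
theorem HasMobiusNeighborhood.exists_preconnected {E : Type*} [TopologicalSpace E] {S C : Set E}
    (h : HasMobiusNeighborhood S C) {W : Set E} (hW : IsOpen W) (hCW : C ⊆ W) :
    ∃ G : Set E, IsOpen G ∧ C ⊆ G ∧ ∃ Z : Set E, IsPreconnected Z ∧ Z ⊆ (S ∩ W) \ C ∧
      (G ∩ S) \ C ⊆ Z := by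
  obtain ⟨N, hNS, ⟨U, hU, hCU, hUN⟩, e, he⟩ := h
  have hCN : ∀ n : N, (n : E) ∈ C ↔ e n ∈ MobiusStrip.core := by
    intro n
    rw [← he]
    constructor
    · rintro ⟨m, hm, hmn⟩
      rwa [← Subtype.ext hmn]
    · exact fun hn => ⟨n, hn, rfl⟩
  obtain ⟨ε, hε, hsub⟩ := MobiusStrip.exists_height_lt_subset
    (O := e.symm ⁻¹' (Subtype.val ⁻¹' W))
    ((hW.preimage continuous_subtype_val).preimage e.symm.continuous) (by
      intro m hm
      apply hCW
      rw [hCN]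
      simpa using hm)
  have hopen : IsOpen (e ⁻¹' {m | MobiusStrip.height m < ε}) :=
    (isOpen_lt MobiusStrip.continuous_height continuous_const).preimage e.continuous
  obtain ⟨G, hG, hGe⟩ := isOpen_induced_iff.1 hopen
  have hmemG : ∀ n : N, (n : E) ∈ G ↔ MobiusStrip.height (e n) < ε := fun n => Set.ext_iff.1 hGe n
  -- `G` bounds the height only for points of `N`; intersecting with `U` forces the points of `S`
  -- into `N`.
  refine ⟨G ∩ U, hG.inter hU, ?_,
    Subtype.val '' (e ⁻¹' {m | 0 < MobiusStrip.height m ∧ MobiusStrip.height m < ε}), ?_, ?_, ?_⟩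
  · intro x hx
    refine ⟨?_, hCU hx⟩
    rw [← he] at hx
    obtain ⟨n, hn, rfl⟩ := hx
    rw [hmemG]
    have : MobiusStrip.height (e n) = 0 := by
      have hn' : e n ∈ MobiusStrip.core := hn
      rwa [MobiusStrip.core_eq] at hn'
    rwa [this]
  · exact (e.isPreconnected_preimage.2 (MobiusStrip.isPreconnected_height hε)).image _
      continuous_subtype_val.continuousOn
  · rintro _ ⟨n, hn, rfl⟩
    refine ⟨⟨hNS n.2, ?_⟩, ?_⟩
    · have := hsub hn.2
      simpa using this
    · rw [hCN, MobiusStrip.core_eq]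
      exact hn.1.ne'
  · rintro x ⟨⟨⟨hxG, hxU⟩, hxS⟩, hxC⟩
    have hxN := hUN ⟨hxU, hxS⟩
    refine ⟨⟨x, hxN⟩, ⟨?_, (hmemG ⟨x, hxN⟩).1 hxG⟩, rfl⟩
    refine (MobiusStrip.height_nonneg _).lt_of_ne fun h0 => hxC ?_
    rw [show x = ((⟨x, hxN⟩ : N) : E) from rfl, hCN, MobiusStrip.core_eq]
    exact h0.symm

/-! ### Walks and graphs all of whose vertices have degree two -/

theorem Relation.ReflTransGen.imp {α : Type*} {r p : α → α → Prop} (h : ∀ a b, r a b → p a b)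
    {x y : α} (hxy : Relation.ReflTransGen r x y) : Relation.ReflTransGen p x y := by
  induction hxy with
  | refl => exact .refl
  | tail _ hab ih => exact ih.tail (h _ _ hab)

/-- A walk leaving `P` has a last vertex before it leaves `P` for the first time. -/
theorem Relation.ReflTransGen.exists_exit {α : Type*} {r : α → α → Prop} {P : α → Prop} {x y : α}
    (h : Relation.ReflTransGen r x y) (hx : P x) (hy : ¬ P y) :
    ∃ p q, Relation.ReflTransGen (fun s t => r s t ∧ P s ∧ P t) x p ∧ P p ∧ r p q ∧ ¬ P q := by
  induction h using Relation.ReflTransGen.head_induction_on with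
  | refl => exact absurd hx hy
  | @head s t hst _ ih =>
    by_cases ht : P t
    · obtain ⟨p, q, h1, h2⟩ := ih ht
      exact ⟨p, q, h1.head ⟨hst, hx, ht⟩, h2⟩
    · exact ⟨s, t, .refl, hx, hst, ht⟩

/-- In a cycle, an arc that starts at a neighbour of `r` ends at a neighbour of `s`. -/
theorem SimpleGraph.exists_arc {V : Type*} [Fintype V] (G : SimpleGraph V) [DecidableRel G.Adj]
    (hdeg : ∀ p q, G.Adj p q → G.degree p = 2) {r s x : V} (hne : r ≠ s) (hrs : ¬ G.Adj r s)
    (hreach : G.Reachable r s) (hx : G.Adj r x) :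
    ∃ y, Relation.ReflTransGen (fun p q => G.Adj p q ∧ (p ≠ r ∧ p ≠ s) ∧ (q ≠ r ∧ q ≠ s)) x y ∧
      (y ≠ r ∧ y ≠ s) ∧ G.Adj y s := by
  classical
  by_contra! hcon
  set R := fun p q => G.Adj p q ∧ (p ≠ r ∧ p ≠ s) ∧ (q ≠ r ∧ q ≠ s) with hR
  have hx' : x ≠ r ∧ x ≠ s := ⟨hx.ne', fun h => hrs (h ▸ hx)⟩
  have hX : ∀ y, Relation.ReflTransGen R x y → y ≠ r ∧ y ≠ s := by
    intro y hy
    induction hy with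
    | refl => exact hx'
    | tail _ h _ => exact h.2.2
  have hnext : ∀ y q, Relation.ReflTransGen R x y → G.Adj y q →
      q = r ∨ Relation.ReflTransGen R x q := by
    intro y q hy hyq
    by_cases hq : q = r
    · exact Or.inl hq
    · refine Or.inr (hy.tail ⟨hyq, hX y hy, hq, ?_⟩)
      rintro rfl
      exact hcon y hy (hX y hy) hyq
  -- If the arc contains all neighbours of `r`, then the arc together with `r` is closed under
  -- adjacency, and so contains `s`.
  by_cases hA : ∀ q, G.Adj r q → Relation.ReflTransGen R x q
  · have : ∀ q, G.Reachable r q → q = r ∨ Relation.ReflTransGen R x q := by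
      intro q hq
      rw [SimpleGraph.reachable_iff_reflTransGen] at hq
      induction hq with
      | refl => exact Or.inl rfl
      | tail _ h ih =>
        rcases ih with rfl | ih
        · exact Or.inr (hA _ h)
        · exact hnext _ _ ih h
    rcases this s hreach with h | h
    · exact hne h.symm
    · exact (hX s h).2 rfl
  · push Not at hA
    obtain ⟨x', hx'r, hx'n⟩ := hA
    -- Otherwise `r` has degree one in the graph induced on the arc together with `r`, while every
    -- other vertex there keeps its degree two. This contradicts the parity of the number of
    -- vertices of odd degree.
    let Y : Set V := {y | y = r ∨ Relation.ReflTransGen R x y}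
    let H : SimpleGraph V :=
      { Adj := fun p q => G.Adj p q ∧ p ∈ Y ∧ q ∈ Y
        symm := ⟨fun p q h => ⟨h.1.symm, h.2.2, h.2.1⟩⟩
        loopless := ⟨fun p h => h.1.ne rfl⟩ }
    have hHr : H.neighborFinset r = {x} := by
      have hxx' : x ≠ x' := fun h => hx'n (h ▸ .refl)
      have h2 : {x, x'} = G.neighborFinset r := by
        apply Finset.eq_of_subset_of_card_le
        · intro z hz
          simp only [Finset.mem_insert, Finset.mem_singleton] at hz
          rcases hz with rfl | rfl <;> simpa
        · rw [SimpleGraph.card_neighborFinset_eq_degree, hdeg r x hx, Finset.card_pair hxx']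
      ext z
      simp only [SimpleGraph.mem_neighborFinset, Finset.mem_singleton]
      constructor
      · rintro ⟨h, -, hz⟩
        have : z ∈ ({x, x'} : Finset V) := by rw [h2]; simpa
        simp only [Finset.mem_insert, Finset.mem_singleton] at this
        rcases this with rfl | rfl
        · rfl
        · rcases hz with hz | hz
          · exact absurd (hz ▸ hx'r) (G.loopless.irrefl r)
          · exact absurd hz hx'n
      · rintro rfl
        exact ⟨hx, Or.inl rfl, Or.inr .refl⟩
    have hodd : Odd (H.degree r) := by
      rw [← SimpleGraph.card_neighborFinset_eq_degree, hHr]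
      simp
    obtain ⟨w, hwr, hw⟩ := H.exists_ne_odd_degree_of_exists_odd_degree r hodd
    have hpos : 0 < H.degree w := hw.pos
    rw [SimpleGraph.degree_pos_iff_exists_adj] at hpos
    obtain ⟨z, hz⟩ := hpos
    have hwX : Relation.ReflTransGen R x w := hz.2.1.resolve_left hwr
    have : H.degree w = G.degree w := by
      rw [← SimpleGraph.card_neighborFinset_eq_degree, ← SimpleGraph.card_neighborFinset_eq_degree]
      congr 1
      ext q
      simp only [SimpleGraph.mem_neighborFinset]
      exact ⟨fun h => h.1, fun h => ⟨h, Or.inr hwX, hnext _ _ hwX h⟩⟩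
    rw [this, hdeg w z hz.1] at hw
    exact absurd hw (by decide)

namespace PreAbstractSimplicialComplex

variable {V : Type*} {K : PreAbstractSimplicialComplex V}

/-! ### Faces of pseudomanifolds -/

theorem exists_facet [Finite V] {F : Finset V} (hF : K.IsFace F) : ∃ G, K.IsFacet G ∧ F ⊆ G := by
  obtain ⟨G, ⟨hG, hFG⟩, hmax⟩ := (Set.toFinite {G | K.IsFace G ∧ F ⊆ G}).exists_maximalFor
    Finset.card _ ⟨F, hF, subset_rfl⟩
  refine ⟨G, ⟨hG, fun H hH hGH => ?_⟩, hFG⟩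
  exact Finset.eq_of_subset_of_card_le hGH
    (hmax ⟨hH, hFG.trans hGH⟩ (Finset.card_le_card hGH))

section

variable [DecidableEq V]

theorem singleton_mem_link {σ : Finset V} {x : V} :
    {x} ∈ (K.link σ).faces ↔ x ∉ σ ∧ insert x σ ∈ K.faces := by
  change ({x} : Finset V).Nonempty ∧ Disjoint σ {x} ∧ σ ∪ {x} ∈ K.faces ↔ _
  rw [Finset.union_comm, ← Finset.insert_eq]
  simp

theorem pair_mem_link {σ : Finset V} {x y : V} :
    {x, y} ∈ (K.link σ).faces ↔ x ∉ σ ∧ y ∉ σ ∧ insert x (insert y σ) ∈ K.faces := by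
  change ({x, y} : Finset V).Nonempty ∧ Disjoint σ {x, y} ∧ σ ∪ {x, y} ∈ K.faces ↔ _
  rw [Finset.union_comm, Finset.insert_union, ← Finset.insert_eq]
  simp [and_assoc]

end

variable [Fintype V]

theorem IsPseudomanifold.isFacet_iff {d : ℕ} (hK : K.IsPseudomanifold d) {F : Finset V} :
    K.IsFacet F ↔ F ∈ K.faces ∧ F.card = d + 1 := by
  constructor
  · intro h
    have hc := hK.pure F h
    refine ⟨h.1.resolve_left ?_, hc⟩
    rintro rfl
    simp at hc
  · rintro ⟨h, hc⟩
    obtain ⟨G, hG, hFG⟩ := exists_facet (Or.inr h)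
    rwa [Finset.eq_of_subset_of_card_le hFG (by rw [hK.pure G hG, hc])]

theorem IsPseudomanifold.exists_face {d : ℕ} (hK : K.IsPseudomanifold d) {F : Finset V}
    (hF : K.IsFace F) : ∃ G ∈ K.faces, F ⊆ G ∧ G.card = d + 1 := by
  obtain ⟨G, hG, hFG⟩ := exists_facet hF
  have := hK.isFacet_iff.1 hG
  exact ⟨G, this.1, hFG, this.2⟩

variable [DecidableEq V]

/-- The ridge condition in terms of apex vertices, the form in which all later arguments use it. -/
theorem IsPseudomanifold.exists_cofacets {d : ℕ} (hK : K.IsPseudomanifold d) {T : Finset V}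
    (hT : T ∈ K.faces) (hc : T.card = d) : ∃ x y, x ≠ y ∧ x ∉ T ∧ y ∉ T ∧ insert x T ∈ K.faces ∧
      insert y T ∈ K.faces ∧ ∀ z, z ∉ T → insert z T ∈ K.faces → z = x ∨ z = y := by
  obtain ⟨F, G, hFG, h⟩ := Set.ncard_eq_two.1 (hK.ridge T (Or.inr hT) hc)
  have aux : ∀ H, K.IsFacet H ∧ T ⊆ H → ∃ x, x ∉ T ∧ insert x T = H := by
    rintro H ⟨hH, hTH⟩
    have hcH := hK.pure H hH
    have : (H \ T).card = 1 := by rw [Finset.card_sdiff_of_subset hTH]; omega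
    obtain ⟨x, hx⟩ := Finset.card_eq_one.1 this
    have hxm : x ∈ H \ T := by simp [hx]
    refine ⟨x, (Finset.mem_sdiff.1 hxm).2, ?_⟩
    rw [Finset.insert_eq, ← hx, Finset.sdiff_union_of_subset hTH]
  have hF : K.IsFacet F ∧ T ⊆ F := by
    have : F ∈ {σ | K.IsFacet σ ∧ T ⊆ σ} := by rw [h]; simp
    exact this
  have hG : K.IsFacet G ∧ T ⊆ G := by
    have : G ∈ {σ | K.IsFacet σ ∧ T ⊆ σ} := by rw [h]; simp
    exact this
  obtain ⟨x, hxT, hxF⟩ := aux F hF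
  obtain ⟨y, hyT, hyG⟩ := aux G hG
  refine ⟨x, y, ?_, hxT, hyT, hxF ▸ (hK.isFacet_iff.1 hF.1).1, hyG ▸ (hK.isFacet_iff.1 hG.1).1, ?_⟩
  · rintro rfl
    exact hFG (hxF.symm.trans hyG)
  · intro z hzT hz
    have hzf : insert z T ∈ {σ | K.IsFacet σ ∧ T ⊆ σ} :=
      ⟨hK.isFacet_iff.2 ⟨hz, by rw [Finset.card_insert_of_notMem hzT, hc]⟩, Finset.subset_insert _ _⟩
    rw [h, ← hxF, ← hyG] at hzf
    rcases hzf with hzf | hzf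
    · exact Or.inl ((Finset.insert_inj hzT).1 hzf)
    · exact Or.inr ((Finset.insert_inj hzT).1 hzf)

/-! ### Walks in links -/

theorem IsNormalPseudomanifold.walk_link {d : ℕ} (hK : K.IsNormalPseudomanifold d) {σ : Finset V}
    (hσ : σ.card + 1 ≤ d) {x y : V} (hx : x ∉ σ) (hxK : insert x σ ∈ K.faces) (hy : y ∉ σ)
    (hyK : insert y σ ∈ K.faces) : Relation.ReflTransGen
      (fun p q => p ∉ σ ∧ q ∉ σ ∧ insert p (insert q σ) ∈ K.faces) x y := by
  have hface : K.IsFace σ := by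
    rcases σ.eq_empty_or_nonempty with h | h
    · exact Or.inl h
    · exact Or.inr (mem_of_subset hxK (Finset.subset_insert _ _) h)
  have := reflTransGen_of_isConnected (hK.connected_link σ hface hσ)
    (singleton_mem_link.2 ⟨hx, hxK⟩) (singleton_mem_link.2 ⟨hy, hyK⟩)
  simpa only [pair_mem_link] using this

/-- `K.LinkWalk τ σ x y`: there is a walk from `x` to `y` in the link of `σ` that avoids `τ`. -/
def LinkWalk (K : PreAbstractSimplicialComplex V) (τ σ : Finset V) : V → V → Prop :=
  Relation.ReflTransGen (fun p q => p ∉ τ ∧ q ∉ τ ∧ insert p (insert q σ) ∈ K.faces)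

/-- A walk from `x` to `z` in the connected link of `σ` is stopped just before it first enters `τ`.
-/
theorem IsNormalPseudomanifold.exists_linkWalk {d : ℕ} (hK : K.IsNormalPseudomanifold d)
    {τ σ : Finset V} (hσ : σ.card + 1 ≤ d) (hστ : σ ⊆ τ) {x z : V} (hx : x ∉ τ)
    (hxK : insert x σ ∈ K.faces) (hzσ : z ∉ σ) (hz : z ∈ τ) (hzK : insert z σ ∈ K.faces) :
    ∃ p q, K.LinkWalk τ σ x p ∧ p ∉ τ ∧ q ∈ τ ∧ q ∉ σ ∧ insert p (insert q σ) ∈ K.faces := by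
  obtain ⟨p, q, h1, h2, h3, h4⟩ := (hK.walk_link hσ (fun h => hx (hστ h)) hxK hzσ hzK).exists_exit
    (P := fun p => p ∉ τ) hx (by simpa using hz)
  refine ⟨p, q, ?_, h2, by simpa using h4, h3.2.1, h3.2.2⟩
  exact Relation.ReflTransGen.imp (fun s t h => ⟨h.2.1, h.2.2, h.1.2.2⟩) h1

/-- In the link of an edge of a missing tetrahedron, each arc between the two other vertices joins
neighbours of both of them. -/
theorem IsNormalPseudomanifold.exists_arc (hK : K.IsNormalPseudomanifold 3) {e : Finset V}
    (he : e.card = 2) {r s x : V} (hr : r ∉ e) (hs : s ∉ e) (hrs : r ≠ s)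
    (hmiss : insert r (insert s e) ∉ K.faces) (hrK : insert r e ∈ K.faces)
    (hsK : insert s e ∈ K.faces) (hx : x ∉ insert r (insert s e))
    (hxK : insert x (insert r e) ∈ K.faces) :
    ∃ y, K.LinkWalk (insert r (insert s e)) e x y ∧ y ∉ insert r (insert s e) ∧
      insert y (insert s e) ∈ K.faces := by
  classical
  -- The link of `e` as a graph. A vertex with a neighbour has degree two, its neighbours being the
  -- apexes of the two cofacets of `insert p e`.
  let G : SimpleGraph V :=
    { Adj := fun p q => p ≠ q ∧ p ∉ e ∧ q ∉ e ∧ insert p (insert q e) ∈ K.faces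
      symm := ⟨fun p q h => ⟨h.1.symm, h.2.2.1, h.2.1, by rw [Finset.insert_comm]; exact h.2.2.2⟩⟩
      loopless := ⟨fun p h => h.1 rfl⟩ }
  have hdeg : ∀ p q, G.Adj p q → G.degree p = 2 := by
    rintro p q ⟨hpq, hp, hq, hpqK⟩
    obtain ⟨y, z, hyz, hy, hz, hyK, hzK, hall⟩ := hK.exists_cofacets (T := insert p e)
      (mem_of_subset hpqK (by grind) (by simp)) (by rw [Finset.card_insert_of_notMem hp, he])
    have : G.neighborFinset p = {y, z} := by
      ext w
      simp only [SimpleGraph.mem_neighborFinset, Finset.mem_insert, Finset.mem_singleton]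
      constructor
      · rintro ⟨h1, h2, h3, h4⟩
        refine hall w (by grind) (by rwa [Finset.insert_comm])
      · rintro (rfl | rfl)
        · exact ⟨by grind, hp, by grind, by rwa [Finset.insert_comm]⟩
        · exact ⟨by grind, hp, by grind, by rwa [Finset.insert_comm]⟩
    rw [← SimpleGraph.card_neighborFinset_eq_degree, this, Finset.card_pair hyz]
  have hreach : G.Reachable r s := by
    rw [SimpleGraph.reachable_iff_reflTransGen]
    have := hK.walk_link (by omega) hr hrK hs hsK
    clear hrs hmiss hsK hs hx
    induction this with
    | refl => exact .refl
    | @tail p q _ h ih =>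
      -- The walk relation allows repeating a vertex; such steps are dropped.
      by_cases hpq : p = q
      · exact hpq ▸ ih
      · exact ih.tail ⟨hpq, h⟩
  obtain ⟨y, h1, h2, h3⟩ := G.exists_arc hdeg hrs (fun h => hmiss h.2.2.2) hreach
    (x := x) ⟨by grind, hr, by grind, by rwa [Finset.insert_comm]⟩
  refine ⟨y, Relation.ReflTransGen.imp ?_ h1, ?_, h3.2.2.2⟩
  · rintro p q ⟨⟨-, h4, h5, h6⟩, h7, h8⟩
    exact ⟨by grind, by grind, h6⟩
  · have := h3.2.1
    grind

end PreAbstractSimplicialComplex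

namespace PreAbstractSimplicialComplex

variable {V : Type*} {K : PreAbstractSimplicialComplex V} {τ : Finset V}

/-! ### Two-sided labellings around a missing tetrahedron -/

theorem IsMissingTetrahedron.mem_faces (hτ : K.IsMissingTetrahedron τ) {F : Finset V}
    (hF : F.Nonempty) (h : F ⊆ τ) (hne : F ≠ τ) : F ∈ K.faces :=
  hτ.boundary_le (show F ∈ (simplexBoundary τ).faces from ⟨hF, h.ssubset_of_ne hne⟩)

variable [DecidableEq V]

theorem IsMissingTetrahedron.notMem_of_insert (hτ : K.IsMissingTetrahedron τ) {r x : V}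
    (hr : r ∈ τ) (hx : x ∉ τ.erase r) (hxK : insert x (τ.erase r) ∈ K.faces) : x ∉ τ := by
  intro h
  have : x = r := by grind
  subst this
  rw [Finset.insert_erase hr] at hxK
  exact hτ.notMem hxK

/-- Labels of the faces that contain `c` and do not lie in `τ`, constant along inclusions. -/
def IsLabel (K : PreAbstractSimplicialComplex V) (τ : Finset V) (c : V) (l : Finset V → Bool) :
    Prop :=
  ∀ F G, c ∈ F → ¬ F ⊆ τ → F ⊆ G → G ∈ K.faces → l F = l G

/-- The faces attached to consecutive vertices of the walk lie in a common face, which is not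
contained in `τ`. -/
theorem IsLabel.linkWalk {c : V} {l : Finset V → Bool} (hl : IsLabel K τ c l) {σ : Finset V}
    (hc : c ∈ σ) {x y : V} (h : K.LinkWalk τ σ x y) : l (insert x σ) = l (insert y σ) := by
  induction h with
  | refl => rfl
  | @tail p q _ h ih =>
    rw [ih, hl (insert p σ) (insert p (insert q σ)) (by grind) (by grind) (by grind) h.2.2,
      hl (insert q σ) (insert p (insert q σ)) (by grind) (by grind) (by grind) h.2.2]

theorem not_insert_subset {x : V} (hx : x ∉ τ) (σ : Finset V) : ¬ insert x σ ⊆ τ :=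
  fun h => hx (h (Finset.mem_insert_self _ _))

/-- Used with `q` in `τ` outside `σ`: the label of `F` is moved to a face sharing one more vertex
with `τ`. -/
theorem IsLabel.eq_of_linkWalk {c : V} {l : Finset V → Bool} (hl : IsLabel K τ c l)
    {σ F : Finset V} {x p q : V} (hcσ : c ∈ σ) (hσF : σ ⊆ F) (hF : F ∈ K.faces) (hxF : x ∈ F)
    (hx : x ∉ τ) (hp : p ∉ τ) (h : K.LinkWalk τ σ x p) (hpq : insert p (insert q σ) ∈ K.faces) :
    l F = l (insert p (insert q σ)) := by
  rw [← hl (insert x σ) F (Finset.mem_insert_of_mem hcσ) (not_insert_subset hx _)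
      (Finset.insert_subset hxF hσF) hF, hl.linkWalk hcσ h]
  exact hl _ _ (Finset.mem_insert_of_mem hcσ) (not_insert_subset hp _)
    (Finset.insert_subset_insert _ (Finset.subset_insert _ _)) hpq

/-- An arc around the edge of `τ` that omits `r` and `s` carries the label between cofacets of the
two triangles at that edge. -/
theorem IsLabel.eq_of_arc {c : V} {l : Finset V → Bool} (hl : IsLabel K τ c l) {r s z w : V}
    (hc : c ∈ τ) (hrc : r ≠ c) (hsc : s ≠ c) (hz : z ∉ τ) (hw : w ∉ τ)
    (hzK : insert z (τ.erase s) ∈ K.faces) (hwK : insert w (τ.erase r) ∈ K.faces)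
    (h : K.LinkWalk τ ((τ.erase r).erase s) z w) :
    l (insert z (τ.erase s)) = l (insert w (τ.erase r)) := by
  have hce : c ∈ (τ.erase r).erase s :=
    Finset.mem_erase.2 ⟨hsc.symm, Finset.mem_erase.2 ⟨hrc.symm, hc⟩⟩
  have h1 := hl.linkWalk hce h
  rwa [hl _ (insert z (τ.erase s)) (Finset.mem_insert_of_mem hce) (not_insert_subset hz _)
      (Finset.insert_subset_insert _ (Finset.erase_subset_erase _ (Finset.erase_subset _ _))) hzK,
    hl _ (insert w (τ.erase r)) (Finset.mem_insert_of_mem hce) (not_insert_subset hw _)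
      (Finset.insert_subset_insert _ (Finset.erase_subset _ _)) hwK] at h1

theorem ne_of_insert_eq_erase {c q s : V} {σ : Finset V} (hc : c ∈ σ)
    (h : insert q σ = τ.erase s) : s ≠ c := by
  rintro rfl
  have : s ∈ τ.erase s := by rw [← h]; exact Finset.mem_insert_of_mem hc
  simp at this

theorem exists_eq_erase (h4 : τ.card = 4) {T : Finset V} (hT : T ⊆ τ) (hc : T.card = 3) :
    ∃ r ∈ τ, T = τ.erase r := by
  have : (τ \ T).card = 1 := by rw [Finset.card_sdiff_of_subset hT]; omega
  obtain ⟨r, hr⟩ := Finset.card_eq_one.1 this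
  have hrm : r ∈ τ \ T := by simp [hr]
  refine ⟨r, by grind, ?_⟩
  rw [Finset.erase_eq, ← hr, Finset.sdiff_sdiff_eq_self hT]

variable [Fintype V]

/-- Adding `c` turns faces of the link outside the curve into faces through `c` not contained in
`τ`. The filled triangle `τ.erase c` causes no exception: it is not in the link because `τ` is
missing. -/
theorem IsMissingTetrahedron.exists_label (hτ : K.IsMissingTetrahedron τ) {c : V} (hc : c ∈ τ)
    (hsep : K.SeparatesLink (τ.erase c) c) : ∃ l, IsLabel K τ c l ∧
      ∃ F G, F ∈ K.faces ∧ c ∈ F ∧ ¬ F ⊆ τ ∧ G ∈ K.faces ∧ c ∈ G ∧ ¬ G ⊆ τ ∧ l F ≠ l G := by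
  obtain ⟨l, hl, F, G, hF, hF', hG, hG', hne⟩ := exists_label_of_card_components hsep
  have hmem : ∀ F ∈ K.faces, c ∈ F → ¬ F ⊆ τ →
      F.erase c ∈ (K.link {c}).faces ∧ F.erase c ∉ (simplexBoundary (τ.erase c)).faces := by
    intro F hF hcF hFτ
    refine ⟨⟨?_, by simp, ?_⟩, ?_⟩
    · obtain ⟨z, hzF, hz⟩ := Finset.not_subset.1 hFτ
      exact ⟨z, Finset.mem_erase.2 ⟨fun h => hz (h ▸ hc), hzF⟩⟩
    · rwa [← Finset.insert_eq, Finset.insert_erase hcF]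
    · intro h
      have := h.2.subset
      exact hFτ fun z hz => if hzc : z = c then hzc ▸ hc else
        Finset.erase_subset _ _ (this (Finset.mem_erase.2 ⟨hzc, hz⟩))
  have hback : ∀ F, F ∈ (K.link {c}).faces → F ∉ (simplexBoundary (τ.erase c)).faces →
      insert c F ∈ K.faces ∧ ¬ insert c F ⊆ τ ∧ (insert c F).erase c = F := by
    rintro F ⟨h1, h2, h3⟩ h4
    have hcF : c ∉ F := by simpa using h2
    rw [← Finset.insert_eq] at h3
    refine ⟨h3, fun h => ?_, Finset.erase_insert hcF⟩
    apply h4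
    refine ⟨h1, Finset.ssubset_iff_subset_ne.2 ⟨fun z hz => Finset.mem_erase.2
      ⟨fun e => hcF (e ▸ hz), h (Finset.mem_insert_of_mem hz)⟩, ?_⟩⟩
    rintro rfl
    rw [Finset.insert_erase hc] at h3
    exact hτ.notMem h3
  refine ⟨fun F => l (F.erase c), ?_, insert c F, insert c G, ?_⟩
  · intro F G hcF hFτ hFG hG
    have hFK : F ∈ K.faces := mem_of_subset hG hFG ⟨c, hcF⟩
    have h1 := hmem F hFK hcF hFτ
    have h2 := hmem G hG (hFG hcF) (fun h => hFτ (hFG.trans h))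
    exact hl _ _ h1.1 h1.2 h2.1 h2.2 (Finset.erase_subset_erase _ hFG)
  · have h1 := hback F hF hF'
    have h2 := hback G hG hG'
    refine ⟨h1.1, by simp, h1.2.1, h2.1, by simp, h2.2.1, ?_⟩
    simpa only [h1.2.2, h2.2.2] using hne

/-- Walking around an edge of a missing tetrahedron from one triangle to another. -/
theorem IsNormalPseudomanifold.exists_arc_erase (hK : K.IsNormalPseudomanifold 3)
    (hτ : K.IsMissingTetrahedron τ) {r s z : V} (hr : r ∈ τ) (hs : s ∈ τ) (hrs : r ≠ s)
    (hz : z ∉ τ) (hzK : insert z (τ.erase s) ∈ K.faces) :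
    ∃ y, y ∉ τ ∧ insert y (τ.erase r) ∈ K.faces ∧ K.LinkWalk τ ((τ.erase r).erase s) z y := by
  have h4 := hτ.card_eq
  set e := (τ.erase r).erase s with he
  have hse : insert s e = τ.erase r := Finset.insert_erase (by grind)
  have hre : insert r e = τ.erase s := by
    rw [he, Finset.erase_right_comm]; exact Finset.insert_erase (by grind)
  have hτe : insert r (insert s e) = τ := by rw [hse]; exact Finset.insert_erase hr
  have hne : ∀ i ∈ τ, τ.erase i ∈ K.faces := fun i hi =>
    hτ.mem_faces (by rw [← Finset.card_pos, Finset.card_erase_of_mem hi]; omega)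
      (Finset.erase_subset _ _) (by grind)
  obtain ⟨y, h1, h2, h3⟩ := hK.exists_arc (e := e) (r := r) (s := s) (x := z)
    (by rw [he, Finset.card_erase_of_mem (by grind), Finset.card_erase_of_mem hr]; omega)
    (by grind) (by grind) hrs (by rw [hτe]; exact hτ.notMem)
    (by rw [hre]; exact hne s hs) (by rw [hse]; exact hne r hr) (by rwa [hτe])
    (by rwa [hre])
  rw [hτe] at h1 h2
  rw [hse] at h3
  exact ⟨y, h2, h3, h1⟩

/-- A face outside `τ` containing a proper face `σ` of `τ` of dimension at most one can be walked
along the link of `σ` to a face containing a larger face of `τ`. -/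
theorem IsNormalPseudomanifold.exists_linkWalk_of_mem (hK : K.IsNormalPseudomanifold 3)
    (hτ : K.IsMissingTetrahedron τ) {σ : Finset V} (hσ : σ ⊆ τ) (hc : σ.card ≤ 2) {x : V}
    (hx : x ∉ τ) (hxK : insert x σ ∈ K.faces) :
    ∃ p q, K.LinkWalk τ σ x p ∧ p ∉ τ ∧ q ∈ τ ∧ q ∉ σ ∧ insert p (insert q σ) ∈ K.faces := by
  have h4 := hτ.card_eq
  obtain ⟨z, hz, hzσ⟩ : ∃ z ∈ τ, z ∉ σ := by
    by_contra! h
    have := Finset.card_le_card (s := τ) (t := σ) h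
    omega
  refine hK.exists_linkWalk (by omega) hσ hx hxK hzσ hz (hτ.mem_faces (by simp) (by grind) ?_)
  intro h
  have := Finset.card_insert_le z σ
  rw [h] at this
  omega

/-- Equal labels at one triangle through `c` would spread around the edges of `τ` at `c` to the
cofacets of all triangles of `τ` through `c`, and from there to all faces at `c`. The label would
then be constant, so the curve would not separate. -/
theorem IsLabel.cofacet_ne (hK : K.IsNormalPseudomanifold 3) (hτ : K.IsMissingTetrahedron τ)
    {c : V} (hcτ : c ∈ τ) {l : Finset V → Bool} (hl : IsLabel K τ c l)
    (hne : ∃ F G, F ∈ K.faces ∧ c ∈ F ∧ ¬ F ⊆ τ ∧ G ∈ K.faces ∧ c ∈ G ∧ ¬ G ⊆ τ ∧ l F ≠ l G)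
    {r x y : V} (hr : r ∈ τ) (hrc : r ≠ c) (hx : x ∉ τ) (hy : y ∉ τ) (hxy : x ≠ y)
    (hxK : insert x (τ.erase r) ∈ K.faces) (hyK : insert y (τ.erase r) ∈ K.faces) :
    l (insert x (τ.erase r)) ≠ l (insert y (τ.erase r)) := by
  intro heq
  have h4 := hτ.card_eq
  have claim₀ : ∀ z, z ∉ τ → insert z (τ.erase r) ∈ K.faces →
      l (insert z (τ.erase r)) = l (insert x (τ.erase r)) := by
    intro z hz hzK
    obtain ⟨x₀, y₀, -, -, -, -, -, hall⟩ := hK.exists_cofacets (T := τ.erase r)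
      (mem_of_subset hzK (by grind) ⟨c, by grind⟩) (by rw [Finset.card_erase_of_mem hr]; omega)
    have h1 := hall x (by grind) hxK
    have h2 := hall y (by grind) hyK
    have h3 := hall z (by grind) hzK
    have : z = x ∨ z = y := by grind
    rcases this with rfl | rfl
    · rfl
    · exact heq.symm
  have claim₁ : ∀ s ∈ τ, s ≠ c → ∀ z, z ∉ τ → insert z (τ.erase s) ∈ K.faces →
      l (insert z (τ.erase s)) = l (insert x (τ.erase r)) := by
    intro s hs hsc z hz hzK
    by_cases hrs : r = s
    · subst hrs; exact claim₀ z hz hzK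
    obtain ⟨w, hw, hwK, hwalk⟩ := hK.exists_arc_erase hτ hr hs hrs hz hzK
    rw [← claim₀ w hw hwK]
    exact hl.eq_of_arc hcτ hrc hsc hz hw hzK hwK hwalk
  -- Two walks lead from `F` to a cofacet of a triangle of `τ`: the first in the link of `c`, the
  -- second in the link of an edge `cq` of `τ`.
  have claim₂ : ∀ F ∈ K.faces, c ∈ F → ¬ F ⊆ τ → l F = l (insert x (τ.erase r)) := by
    intro F hF hcF hFτ
    obtain ⟨z, hzF, hz⟩ := Finset.not_subset.1 hFτ
    have hzK : insert z {c} ∈ K.faces := mem_of_subset hF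
      (by simp [Finset.insert_subset_iff, hzF, hcF]) (by simp)
    obtain ⟨p, q, h1, h2, h3, h5, h6⟩ := hK.exists_linkWalk_of_mem hτ (σ := {c}) (by simpa)
      (by simp) hz hzK
    obtain ⟨p', q', h1', h2', h3', h5', h6'⟩ := hK.exists_linkWalk_of_mem hτ
      (σ := insert q {c}) (by simp [Finset.insert_subset_iff, h3, hcτ]) Finset.card_le_two h2 h6
    obtain ⟨s, hs, hse⟩ := exists_eq_erase h4 (T := insert q' (insert q {c}))
      (by simp [Finset.insert_subset_iff, h3, h3', hcτ])
      (by rw [Finset.card_insert_of_notMem h5', Finset.card_insert_of_notMem h5]; rfl)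
    rw [hl.eq_of_linkWalk (by simp) (by simpa) hF hzF hz h2 h1 h6,
      hl.eq_of_linkWalk (by simp) (Finset.subset_insert _ _) h6 (by simp) h2 h2' h1' h6', hse]
    rw [hse] at h6'
    exact claim₁ s hs (ne_of_insert_eq_erase (by simp) hse) p' h2' h6'
  obtain ⟨F, G, hF, hcF, hFτ, hG, hcG, hGτ, h⟩ := hne
  exact h ((claim₂ F hF hcF hFτ).trans (claim₂ G hG hcG hGτ).symm)

/-- Compatible labellings of the two sides of `∂τ` at `a` and at `b`. -/
structure FoldLabelling (K : PreAbstractSimplicialComplex V) (τ : Finset V) (a b : V)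
    (l : V → Finset V → Bool) : Prop where
  mono : ∀ x F G, x ∈ F → ¬ F ⊆ τ → F ⊆ G → G ∈ K.faces → l x F = l x G
  agree : ∀ F ∈ K.faces, a ∈ F → b ∈ F → ¬ F ⊆ τ → l a F = l b F
  other : ∀ x F, x ≠ a → x ≠ b → l x F = false
  cofacet : ∀ c r x y, c = a ∨ c = b → r ∈ τ → r ≠ c → x ∉ τ → y ∉ τ → x ≠ y →
    insert x (τ.erase r) ∈ K.faces → insert y (τ.erase r) ∈ K.faces →
    l c (insert x (τ.erase r)) ≠ l c (insert y (τ.erase r))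

/-- On faces through `a` and `b`, both labels are determined by their values on the two cofacets of
one triangle `τ.erase v`. Each label separates these cofacets, so the two labels are equal or
opposite, and flipping one of them makes them agree. -/
theorem IsNormalPseudomanifold.exists_foldLabelling (hK : K.IsNormalPseudomanifold 3)
    (hτ : K.IsMissingTetrahedron τ) {a b : V} (ha : a ∈ τ) (hb : b ∈ τ) (hab : a ≠ b)
    (hsa : K.SeparatesLink (τ.erase a) a) (hsb : K.SeparatesLink (τ.erase b) b) :
    ∃ l, FoldLabelling K τ a b l := by
  have h4 := hτ.card_eq
  obtain ⟨la, hla, hna⟩ := hτ.exists_label ha hsa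
  obtain ⟨lb, hlb, hnb⟩ := hτ.exists_label hb hsb
  have hca := fun {r x y} => hla.cofacet_ne hK hτ ha hna (r := r) (x := x) (y := y)
  have hcb := fun {r x y} => hlb.cofacet_ne hK hτ hb hnb (r := r) (x := x) (y := y)
  obtain ⟨v, hv, hva, hvb⟩ : ∃ v ∈ τ, v ≠ a ∧ v ≠ b := by
    by_contra! h
    have := Finset.card_le_card (s := τ) (t := {a, b}) (fun x hx => by
      by_cases hxa : x = a
      · simp [hxa]
      · simp [h x hx hxa])
    have := Finset.card_le_two (a := a) (b := b)
    omega
  obtain ⟨x₁, x₂, h12, hx₁, hx₂, hx₁K, hx₂K, hall⟩ := hK.exists_cofacets (T := τ.erase v)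
    (hτ.mem_faces ⟨a, by grind⟩ (Finset.erase_subset _ _) (by grind))
    (by rw [Finset.card_erase_of_mem hv]; omega)
  have hx₁τ := hτ.notMem_of_insert hv hx₁ hx₁K
  have hx₂τ := hτ.notMem_of_insert hv hx₂ hx₂K
  have key : ∀ F ∈ K.faces, a ∈ F → b ∈ F → ¬ F ⊆ τ → ∃ y, (y = x₁ ∨ y = x₂) ∧
      la F = la (insert y (τ.erase v)) ∧ lb F = lb (insert y (τ.erase v)) := by
    intro F hF haF hbF hFτ
    obtain ⟨z, hzF, hz⟩ := Finset.not_subset.1 hFτ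
    have hσF : {a, b} ⊆ F := by simp [Finset.insert_subset_iff, haF, hbF]
    have hστ : {a, b} ⊆ τ := by simp [Finset.insert_subset_iff, ha, hb]
    have hzK : insert z {a, b} ∈ K.faces :=
      mem_of_subset hF (Finset.insert_subset hzF hσF) (by simp)
    obtain ⟨p, q, h1, h2, h3, h5, h6⟩ := hK.exists_linkWalk_of_mem hτ (σ := {a, b}) hστ
      Finset.card_le_two hz hzK
    obtain ⟨s, hs, hse⟩ := exists_eq_erase h4 (T := insert q {a, b})
      (Finset.insert_subset h3 hστ)
      (by rw [Finset.card_insert_of_notMem h5, Finset.card_pair hab])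
    have ea := hla.eq_of_linkWalk (by simp) hσF hF hzF hz h2 h1 h6
    have eb := hlb.eq_of_linkWalk (by simp) hσF hF hzF hz h2 h1 h6
    have hsa : s ≠ a := ne_of_insert_eq_erase (by simp) hse
    have hsb : s ≠ b := ne_of_insert_eq_erase (by simp) hse
    rw [hse] at h6 ea eb
    by_cases hsv : v = s
    · subst hsv
      exact ⟨p, hall p (fun h => h2 (Finset.erase_subset _ _ h)) h6, ea, eb⟩
    obtain ⟨w, hw, hwK, hwalk⟩ := hK.exists_arc_erase hτ hv hs hsv h2 h6
    exact ⟨w, hall w (fun h => hw (Finset.erase_subset _ _ h)) hwK,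
      ea.trans (hla.eq_of_arc ha hva hsa h2 hw h6 hwK hwalk),
      eb.trans (hlb.eq_of_arc hb hvb hsb h2 hw h6 hwK hwalk)⟩
  -- The flip that makes the two labels agree at `x₁`; since both change value from `x₁` to `x₂`,
  -- they then agree at `x₂` too.
  let t := xor (la (insert x₁ (τ.erase v))) (lb (insert x₁ (τ.erase v)))
  refine ⟨fun x F => if x = a then la F else if x = b then xor t (lb F) else false, ?_, ?_, ?_, ?_⟩
  · intro x F G hx hF hFG hG
    split_ifs with h1 h2
    · exact hla F G (h1 ▸ hx) hF hFG hG
    · rw [hlb F G (h2 ▸ hx) hF hFG hG]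
    · rfl
  · intro F hF haF hbF hFτ
    have h1 := hca hv hva hx₁τ hx₂τ h12 hx₁K hx₂K
    have h2 := hcb hv hvb hx₁τ hx₂τ h12 hx₁K hx₂K
    obtain ⟨y, hy, h3, h5⟩ := key F hF haF hbF hFτ
    simp only [if_true, if_neg hab.symm, h3, h5, t]
    rcases hy with rfl | rfl
    · simp
    · revert h1 h2
      generalize la (insert x₁ (τ.erase v)) = i
      generalize la (insert y (τ.erase v)) = j
      generalize lb (insert x₁ (τ.erase v)) = k
      generalize lb (insert y (τ.erase v)) = m
      revert i j k m
      decide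
  · intro x F h1 h2
    simp [h1, h2]
  · rintro c r x y (rfl | rfl) hr hrc hx hy hxy hxK hyK
    · simpa using hca hr hrc hx hy hxy hxK hyK
    · simpa [hab.symm] using hcb hr hrc hx hy hxy hxK hyK

end PreAbstractSimplicialComplex

/-! ### One-sidedness of the curve in the link of u -/

namespace PreAbstractSimplicialComplex

variable {V : Type*} [DecidableEq V] {K : PreAbstractSimplicialComplex V} {τ : Finset V}

variable [Fintype V]

/-- If the boundary of `τ.erase u` has a Möbius neighbourhood in the link of `u`, then labels of
the faces around that curve that are constant along inclusions take the same value on both of its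
sides. -/
theorem IsMissingTetrahedron.label_eq_of_mobius (hτ : K.IsMissingTetrahedron τ) {u c : V}
    (huτ : u ∈ τ) (hc : c ∈ τ.erase u)
    (hu : HasMobiusNeighborhood (K.link {u}).realization (simplexBoundary (τ.erase u)).realization)
    {μ : Finset V → Bool}
    (hμ : ∀ F G, u ∈ F → (∃ d ∈ τ.erase u, d ∈ F) → ¬ F ⊆ τ → F ⊆ G → G ∈ K.faces → μ F = μ G)
    {F₁ F₂ : Finset V} (h₁ : F₁ ∈ K.faces) (hu₁ : u ∈ F₁) (hc₁ : c ∈ F₁) (hτ₁ : ¬ F₁ ⊆ τ)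
    (h₂ : F₂ ∈ K.faces) (hu₂ : u ∈ F₂) (hc₂ : c ∈ F₂) (hτ₂ : ¬ F₂ ⊆ τ) : μ F₁ = μ F₂ := by
  have h4 := hτ.card_eq
  -- A neighbourhood of the curve in which every support meets `τ.erase u`, so that `μ` is constant
  -- along inclusions there.
  let W : Set (V → ℝ) := ⋃ d ∈ τ.erase u, {x | x d ≠ 0}
  have hW : IsOpen W := isOpen_biUnion fun d _ =>
    isOpen_ne_fun (continuous_apply d) continuous_const
  have hmemW : ∀ x, x ∈ W ↔ ∃ d ∈ τ.erase u, d ∈ supp x := by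
    intro x
    simp only [W, Set.mem_iUnion, mem_supp, exists_prop]
    rfl
  have hCW : (simplexBoundary (τ.erase u)).realization ⊆ W := by
    intro x hx
    have hx := mem_realization_iff.1 hx
    obtain ⟨d, hd⟩ := supp_nonempty hx.1
    exact (hmemW x).2 ⟨d, hx.2.2.subset hd, hd⟩
  obtain ⟨G, hG, hCG, Z, hZ, hZS, hGZ⟩ := hu.exists_preconnected hW hCW
  have hmemZ : ∀ z ∈ Z, insert u (supp z) ∈ K.faces ∧ ¬ insert u (supp z) ⊆ τ ∧
      ∃ d ∈ τ.erase u, d ∈ insert u (supp z) := by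
    intro z hz
    obtain ⟨⟨hzS, hzW⟩, hzC⟩ := hZS hz
    obtain ⟨hzs, h1, h2, h3⟩ := mem_realization_iff.1 hzS
    rw [← Finset.insert_eq] at h3
    have huz : u ∉ supp z := by simpa only [Finset.disjoint_singleton_left] using h2
    refine ⟨h3, fun hsub => hzC ?_, ?_⟩
    · refine mem_realization_iff.2 ⟨hzs, h1, Finset.ssubset_iff_subset_ne.2 ⟨fun d hd =>
        Finset.mem_erase.2 ⟨fun e => huz (e ▸ hd), hsub (Finset.mem_insert_of_mem hd)⟩, ?_⟩⟩
      intro h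
      rw [h, Finset.insert_erase huτ] at h3
      exact hτ.notMem h3
    · obtain ⟨d, hd, hdz⟩ := (hmemW z).1 hzW
      exact ⟨d, hd, Finset.mem_insert_of_mem hdz⟩
  have hexists : ∀ F ∈ K.faces, u ∈ F → c ∈ F → ¬ F ⊆ τ → ∃ z ∈ Z, insert u (supp z) = F := by
    intro F hF huF hcF hFτ
    have hcu := (Finset.mem_erase.1 hc).1
    have hcFu : c ∈ F.erase u := Finset.mem_erase.2 ⟨hcu, hcF⟩
    have hpC : bary {c} ∈ (simplexBoundary (τ.erase u)).realization := by
      refine mem_realization_iff.2 ⟨bary_mem (by simp), ?_⟩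
      rw [supp_bary]
      refine ⟨by simp, Finset.ssubset_iff_subset_ne.2 ⟨by simpa using hc, fun h => ?_⟩⟩
      have := congrArg Finset.card h
      rw [Finset.card_erase_of_mem huτ, h4] at this
      simp at this
    -- Moving slightly from the vertex `c` towards the barycentre of `F.erase u` stays in the
    -- neighbourhood `G` of the curve, and at once produces the full support `F.erase u`.
    let p : ℝ → V → ℝ := fun t => (1 - t) • bary {c} + t • bary (F.erase u)
    have hp : Continuous p := by fun_prop
    have hev : ∀ᶠ t in nhds (0 : ℝ), p t ∈ G := by
      apply hp.continuousAt.eventually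
      apply hG.mem_nhds
      simpa [p] using hCG hpC
    obtain ⟨ε, hε, hball⟩ := Metric.eventually_nhds_iff.1 hev
    let t := min (ε / 2) (1 / 2)
    have ht : 0 < t := lt_min (by positivity) (by norm_num)
    have ht1 : t < 1 := (min_le_right _ _).trans_lt (by norm_num)
    have htε : t < ε := (min_le_left _ _).trans_lt (by linarith)
    have hs1 : bary {c} ∈ stdSimplex ℝ V := bary_mem (by simp)
    have hs2 : bary (F.erase u) ∈ stdSimplex ℝ V := bary_mem ⟨c, hcFu⟩
    have hpG : p t ∈ G := hball (by simpa [abs_of_pos ht] using htε)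
    have hsupp : supp (p t) = F.erase u := by
      obtain ⟨h1, -, h3⟩ := supp_combo hs1 hs2 (sub_pos.2 ht1) ht
      rw [supp_bary, supp_bary] at h1
      rw [supp_bary] at h3
      refine Finset.Subset.antisymm (h1.trans ?_) h3
      exact Finset.union_subset (by simpa using hcFu) subset_rfl
    refine ⟨p t, hGZ ⟨⟨hpG, ?_⟩, ?_⟩, by rw [hsupp, Finset.insert_erase huF]⟩
    · refine mem_realization_iff.2 ⟨convex_stdSimplex ℝ V hs1 hs2 (sub_pos.2 ht1).le ht.le
        (by ring), ?_⟩
      rw [hsupp]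
      exact ⟨⟨c, hcFu⟩, by simp, by rwa [← Finset.insert_eq, Finset.insert_erase huF]⟩
    · intro h
      have := (mem_realization_iff.1 h).2.2.subset
      rw [hsupp] at this
      exact hFτ fun d hd => if hdu : d = u then hdu ▸ huτ else
        Finset.erase_subset _ _ (this (Finset.mem_erase.2 ⟨hdu, hd⟩))
  obtain ⟨z₁, hz₁, e₁⟩ := hexists F₁ h₁ hu₁ hc₁ hτ₁
  obtain ⟨z₂, hz₂, e₂⟩ := hexists F₂ h₂ hu₂ hc₂ hτ₂
  have key := hZ.supp_iff (Q := fun s => μ (insert u s) = μ F₁) (fun x hx y hy hxy => by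
    rw [hμ (insert u (supp x)) (insert u (supp y)) (Finset.mem_insert_self _ _) (hmemZ x hx).2.2
      (hmemZ x hx).2.1 (Finset.insert_subset_insert _ hxy) (hmemZ y hy).1]) hz₁ hz₂ (by
      rw [e₁])
  change μ (insert u (supp z₂)) = μ F₁ at key
  rw [← key, e₂]

end PreAbstractSimplicialComplex

namespace PreAbstractSimplicialComplex

variable {V : Type*} [DecidableEq V]

/-! ### Cutting a complex open along the boundary of a missing tetrahedron

The vertices `a` and `b` are doubled, and the two tetrahedra `sideFace τ a b i` are added. -/

/-- The copy of the vertex `x` on the side `i`; only `a` and `b` have two copies. -/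
def side (a b : V) (i : Bool) (x : V) : V × Bool := (x, if x = a ∨ x = b then i else false)

/-- The copy of the tetrahedron `τ` on the side `i`. -/
def sideFace (τ : Finset V) (a b : V) (i : Bool) : Finset (V × Bool) := τ.image (side a b i)

/-- The copy of the face `F` determined by the labels of its vertices. -/
def liftFace (l : V → Finset V → Bool) (F : Finset V) : Finset (V × Bool) :=
  F.image fun x => (x, l x F)

section

variable {τ F : Finset V} {a b : V} {l : V → Finset V → Bool} {i : Bool} {p : V × Bool}

theorem mem_sideFace : p ∈ sideFace τ a b i ↔
    p.1 ∈ τ ∧ p.2 = if p.1 = a ∨ p.1 = b then i else false := by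
  rcases p with ⟨x, j⟩
  simp only [sideFace, Finset.mem_image, side, Prod.mk.injEq]
  constructor
  · rintro ⟨y, hy, rfl, rfl⟩
    exact ⟨hy, rfl⟩
  · rintro ⟨hx, hj⟩
    exact ⟨x, hx, rfl, hj.symm⟩

theorem mem_liftFace : p ∈ liftFace l F ↔ p.1 ∈ F ∧ p.2 = l p.1 F := by
  rcases p with ⟨x, j⟩
  simp only [liftFace, Finset.mem_image, Prod.mk.injEq]
  constructor
  · rintro ⟨y, hy, rfl, rfl⟩
    exact ⟨hy, rfl⟩
  · rintro ⟨hx, hj⟩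
    exact ⟨x, hx, rfl, hj.symm⟩

theorem side_injective (a b : V) (i : Bool) : Function.Injective (side a b i) :=
  fun _ _ h => congrArg Prod.fst h

theorem card_sideFace : (sideFace τ a b i).card = τ.card :=
  Finset.card_image_of_injective _ (side_injective a b i)

theorem image_fst_sideFace : (sideFace τ a b i).image Prod.fst = τ := by
  simp [sideFace, Finset.image_image, Function.comp_def, side]

theorem card_liftFace : (liftFace l F).card = F.card :=
  Finset.card_image_of_injective _ fun _ _ h => congrArg Prod.fst h

theorem image_fst_liftFace : (liftFace l F).image Prod.fst = F := by
  simp [liftFace, Finset.image_image, Function.comp_def]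

theorem liftFace_nonempty (hF : F.Nonempty) : (liftFace l F).Nonempty := hF.image _

end

/-! ### Subfaces of lifted faces -/

namespace FoldLabelling

variable {K : PreAbstractSimplicialComplex V} {τ : Finset V} {a b : V} {l : V → Finset V → Bool}
  (hl : FoldLabelling K τ a b l)

include hl

theorem liftFace_eq {F G : Finset V} (hF : ¬ F ⊆ τ) (hFG : F ⊆ G) (hG : G ∈ K.faces) :
    liftFace l F = F.image fun x => (x, l x G) :=
  Finset.image_congr fun x hx => by
    rw [hl.mono x F G hx hF hFG hG]

theorem liftFace_mono {F G : Finset V} (hF : ¬ F ⊆ τ) (hFG : F ⊆ G) (hG : G ∈ K.faces) :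
    liftFace l F ⊆ liftFace l G := by
  rw [hl.liftFace_eq hF hFG hG]
  exact Finset.image_subset_image hFG

theorem eq_liftFace_of_subset {F : Finset V} (hF : F ∈ K.faces) {G : Finset (V × Bool)}
    (hG : G ⊆ liftFace l F) (hGτ : ¬ G.image Prod.fst ⊆ τ) :
    G = liftFace l (G.image Prod.fst) := by
  have hsub : G.image Prod.fst ⊆ F := by
    rw [← image_fst_liftFace (l := l) (F := F)]
    exact Finset.image_subset_image hG
  rw [hl.liftFace_eq hGτ hsub hF]
  ext p
  simp only [Finset.mem_image]
  constructor
  · intro hp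
    exact ⟨p.1, ⟨p, hp, rfl⟩, Prod.ext rfl (mem_liftFace.1 (hG hp)).2.symm⟩
  · rintro ⟨_, ⟨q, hq, rfl⟩, rfl⟩
    have : (q.1, l q.1 F) = q := Prod.ext rfl (mem_liftFace.1 (hG hq)).2.symm
    rwa [this]

theorem label_of_mem {F : Finset V} (hF : F ∈ K.faces) (hFτ : ¬ F ⊆ τ) {c : V} (hc : c = a ∨ c = b)
    (hcF : c ∈ F) {x : V} (hx : x ∈ F) : l x F = if x = a ∨ x = b then l c F else false := by
  split_ifs with h
  · rcases h with rfl | rfl <;> rcases hc with rfl | rfl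
    · rfl
    · exact hl.agree F hF hx hcF hFτ
    · exact (hl.agree F hF hcF hx hFτ).symm
    · rfl
  · exact hl.other x F (fun e => h (Or.inl e)) (fun e => h (Or.inr e))

/-- Since the labels at `a` and `b` agree, the part of a lifted face over `τ` lies in one copy of
`τ`. If `F` contains neither `a` nor `b`, both copies would do. -/
theorem subset_sideFace {F : Finset V} (hF : F ∈ K.faces) (hFτ : ¬ F ⊆ τ) {G : Finset (V × Bool)}
    (hG : G ⊆ liftFace l F) (hGτ : G.image Prod.fst ⊆ τ) : ∃ i, G ⊆ sideFace τ a b i := by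
  have hmem : ∀ p ∈ G, p.1 ∈ τ ∧ p.1 ∈ F ∧ p.2 = l p.1 F := fun p hp =>
    ⟨hGτ (Finset.mem_image_of_mem _ hp), mem_liftFace.1 (hG hp)⟩
  by_cases h : ∃ c, (c = a ∨ c = b) ∧ c ∈ F
  · obtain ⟨c, hc, hcF⟩ := h
    refine ⟨l c F, fun p hp => ?_⟩
    obtain ⟨h1, h2, h3⟩ := hmem p hp
    exact mem_sideFace.2 ⟨h1, h3.trans (hl.label_of_mem hF hFτ hc hcF h2)⟩
  · push Not at h
    refine ⟨false, fun p hp => ?_⟩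
    obtain ⟨h1, h2, h3⟩ := hmem p hp
    have hn : ¬ (p.1 = a ∨ p.1 = b) := fun e => h _ e h2
    refine mem_sideFace.2 ⟨h1, ?_⟩
    rw [if_neg hn, h3]
    exact hl.other _ _ (fun e => hn (Or.inl e)) (fun e => hn (Or.inr e))

end FoldLabelling

/-- The complex `K`, cut open along `∂τ` with the sides given by `l`, and with both copies of `τ`
added. -/
def unfolding (K : PreAbstractSimplicialComplex V) (τ : Finset V) (a b : V)
    (l : V → Finset V → Bool) (hl : FoldLabelling K τ a b l) :
    PreAbstractSimplicialComplex (V × Bool) where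
  faces := {G | (∃ F ∈ K.faces, ¬ F ⊆ τ ∧ G = liftFace l F) ∨
    (G.Nonempty ∧ ∃ i, G ⊆ sideFace τ a b i)}
  isRelLowerSet_faces := by
    rintro G (⟨F, hF, hFτ, rfl⟩ | ⟨hG, i, hi⟩)
    · refine ⟨liftFace_nonempty (K.isRelLowerSet_faces hF).1, fun H hH hne => ?_⟩
      by_cases hτ : H.image Prod.fst ⊆ τ
      · exact Or.inr ⟨hne, hl.subset_sideFace hF hFτ hH hτ⟩
      · refine Or.inl ⟨_, mem_of_subset hF ?_ (hne.image _), hτ, hl.eq_liftFace_of_subset hF hH hτ⟩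
        rw [← image_fst_liftFace (l := l) (F := F)]
        exact Finset.image_subset_image hH
    · exact ⟨hG, fun H hH hne => Or.inr ⟨hne, i, hH.trans hi⟩⟩

section

variable {K : PreAbstractSimplicialComplex V} {τ : Finset V} {a b : V} {l : V → Finset V → Bool}
  {hl : FoldLabelling K τ a b l}

theorem liftFace_mem_unfolding {F : Finset V} (hF : F ∈ K.faces) (hFτ : ¬ F ⊆ τ) :
    liftFace l F ∈ (K.unfolding τ a b l hl).faces :=
  Or.inl ⟨F, hF, hFτ, rfl⟩

theorem mem_unfolding_of_subset_sideFace {G : Finset (V × Bool)} (hG : G.Nonempty) {i : Bool}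
    (h : G ⊆ sideFace τ a b i) : G ∈ (K.unfolding τ a b l hl).faces :=
  Or.inr ⟨hG, i, h⟩

theorem fst_mem_of_subset_sideFace {G : Finset (V × Bool)} {i : Bool}
    (h : G ⊆ sideFace τ a b i) : G.image Prod.fst ⊆ τ := by
  rw [← image_fst_sideFace (τ := τ) (a := a) (b := b) (i := i)]
  exact Finset.image_subset_image h

theorem mem_unfolding_of_not_subset {G : Finset (V × Bool)}
    (hG : G ∈ (K.unfolding τ a b l hl).faces) (h : ¬ G.image Prod.fst ⊆ τ) :
    G.image Prod.fst ∈ K.faces ∧ G = liftFace l (G.image Prod.fst) := by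
  rcases hG with ⟨F, hF, hFτ, rfl⟩ | ⟨-, i, hi⟩
  · rw [image_fst_liftFace]
    exact ⟨hF, rfl⟩
  · exact absurd (fst_mem_of_subset_sideFace hi) h

theorem mem_unfolding_of_subset {G : Finset (V × Bool)}
    (hG : G ∈ (K.unfolding τ a b l hl).faces) (h : G.image Prod.fst ⊆ τ) :
    ∃ i, G ⊆ sideFace τ a b i := by
  rcases hG with ⟨F, hF, hFτ, rfl⟩ | ⟨-, i, hi⟩
  · rw [image_fst_liftFace] at h
    exact absurd h hFτ
  · exact ⟨i, hi⟩

theorem insert_liftFace {F : Finset V} {x : V} (hF : ¬ F ⊆ τ) (hK : insert x F ∈ K.faces)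
    (hl : FoldLabelling K τ a b l) :
    insert (x, l x (insert x F)) (liftFace l F) = liftFace l (insert x F) := by
  rw [hl.liftFace_eq hF (Finset.subset_insert _ _) hK, liftFace, Finset.image_insert]

/-- The vertices of the link of a face that does not lie over `τ`. -/
theorem mem_link_liftFace {F : Finset V} (hF : ¬ F ⊆ τ) {p : V × Bool} (hp : p ∉ liftFace l F)
    (hpK : insert p (liftFace l F) ∈ (K.unfolding τ a b l hl).faces) :
    p.1 ∉ F ∧ insert p.1 F ∈ K.faces ∧ p.2 = l p.1 (insert p.1 F) := by
  have himg : (insert p (liftFace l F)).image Prod.fst = insert p.1 F := by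
    rw [Finset.image_insert, image_fst_liftFace]
  have h := mem_unfolding_of_not_subset hpK (by
    rw [himg]
    exact fun h => hF ((Finset.subset_insert _ _).trans h))
  rw [himg] at h
  have hmem : p ∈ liftFace l (insert p.1 F) := h.2 ▸ Finset.mem_insert_self _ _
  have h2 := (mem_liftFace.1 hmem).2
  refine ⟨fun hpF => hp ?_, h.1, h2⟩
  rw [Finset.insert_eq_of_mem hpF] at h2
  exact mem_liftFace.2 ⟨hpF, h2⟩

/-- The vertices outside `τ` in the link of a face over `τ`. -/
theorem mem_link_of_notMem {G : Finset (V × Bool)} {p : V × Bool} (hp : p.1 ∉ τ)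
    (hpK : insert p G ∈ (K.unfolding τ a b l hl).faces) :
    insert p.1 (G.image Prod.fst) ∈ K.faces ∧
      insert p G = liftFace l (insert p.1 (G.image Prod.fst)) := by
  have := mem_unfolding_of_not_subset hpK (by
    rw [Finset.image_insert]
    exact not_insert_subset hp _)
  rwa [Finset.image_insert] at this

end

theorem eq_image_side_of_subset {τ : Finset V} {a b : V} {G : Finset (V × Bool)} {i : Bool} (h : G ⊆ sideFace τ a b i) :
    G = (G.image Prod.fst).image (side a b i) := by
  ext p
  simp only [Finset.mem_image]
  have key : ∀ q ∈ G, side a b i q.1 = q := fun q hq =>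
    Prod.ext rfl (mem_sideFace.1 (h hq)).2.symm
  constructor
  · exact fun hp => ⟨p.1, ⟨p, hp, rfl⟩, key p hp⟩
  · rintro ⟨_, ⟨q, hq, rfl⟩, rfl⟩
    rwa [key q hq]

/-! ### The unfolding is a pseudomanifold -/

section

variable {K : PreAbstractSimplicialComplex V} [Fintype V]

/-- Converse of `exists_cofacets`. The condition `d ≠ 0` keeps ridges nonempty, as the empty face is
not recorded in `faces`. -/
theorem isPseudomanifold_of_cofacets {W : Type*} [DecidableEq W] [Fintype W]
    {L : PreAbstractSimplicialComplex W} {d : ℕ}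
    (h : ∀ F, L.IsFace F → ∃ G ∈ L.faces, F ⊆ G ∧ G.card = d + 1)
    (h' : ∀ T ∈ L.faces, T.card = d → ∃ x y, x ≠ y ∧ x ∉ T ∧ y ∉ T ∧ insert x T ∈ L.faces ∧
      insert y T ∈ L.faces ∧ ∀ z, z ∉ T → insert z T ∈ L.faces → z = x ∨ z = y)
    (hd : d ≠ 0) : L.IsPseudomanifold d := by
  have hpure : ∀ σ, L.IsFacet σ → σ.card = d + 1 := by
    rintro σ ⟨h1, h2⟩
    obtain ⟨G, hG, hσG, hc⟩ := h σ h1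
    rw [h2 G (Or.inr hG) hσG, hc]
  have hfacet : ∀ F, F ∈ L.faces → F.card = d + 1 → L.IsFacet F := by
    intro F hF hc
    refine ⟨Or.inr hF, fun τ hτ hFτ => ?_⟩
    obtain ⟨G, hG, hτG, hcG⟩ := h τ hτ
    exact Finset.eq_of_subset_of_card_le hFτ ((Finset.card_le_card hτG).trans (by omega))
  refine ⟨hpure, fun T hT hc => ?_⟩
  have hTL : T ∈ L.faces := hT.resolve_left (by rintro rfl; exact hd (by simpa using hc.symm))
  obtain ⟨x, y, hxy, hx, hy, hxL, hyL, hall⟩ := h' T hTL hc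
  rw [Set.ncard_eq_two]
  refine ⟨insert x T, insert y T, fun e => hxy ((Finset.insert_inj hx).1 e), ?_⟩
  ext F
  simp only [Set.mem_ofPred_eq, Set.mem_insert_iff, Set.mem_singleton_iff]
  constructor
  · rintro ⟨hF, hTF⟩
    have hcF := hpure F hF
    have : (F \ T).card = 1 := by rw [Finset.card_sdiff_of_subset hTF]; omega
    obtain ⟨z, hz⟩ := Finset.card_eq_one.1 this
    have hzm : z ∈ F \ T := by simp [hz]
    have hzT : insert z T = F := by
      rw [Finset.insert_eq, ← hz, Finset.sdiff_union_of_subset hTF]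
    have hFL : F ∈ L.faces := hF.1.resolve_left (by rintro rfl; simp at hcF)
    rcases hall z (Finset.mem_sdiff.1 hzm).2 (hzT ▸ hFL) with rfl | rfl
    · exact Or.inl hzT.symm
    · exact Or.inr hzT.symm
  · rintro (rfl | rfl)
    · exact ⟨hfacet _ hxL (by rw [Finset.card_insert_of_notMem hx, hc]), Finset.subset_insert _ _⟩
    · exact ⟨hfacet _ hyL (by rw [Finset.card_insert_of_notMem hy, hc]), Finset.subset_insert _ _⟩

variable {τ : Finset V} {a b : V} {l : V → Finset V → Bool}

theorem exists_face_unfolding (hK : K.IsPseudomanifold 3) (hτ : K.IsMissingTetrahedron τ)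
    (hl : FoldLabelling K τ a b l) {G : Finset (V × Bool)}
    (hG : (K.unfolding τ a b l hl).IsFace G) :
    ∃ H ∈ (K.unfolding τ a b l hl).faces, G ⊆ H ∧ H.card = 4 := by
  have h4 := hτ.card_eq
  have key : ∀ i, G ⊆ sideFace τ a b i →
      ∃ H ∈ (K.unfolding τ a b l hl).faces, G ⊆ H ∧ H.card = 4 := fun i hi =>
    ⟨_, mem_unfolding_of_subset_sideFace (by rw [← Finset.card_pos, card_sideFace, h4]; norm_num)
      subset_rfl, hi, card_sideFace.trans h4⟩
  rcases hG with rfl | ⟨F, hF, hFτ, rfl⟩ | ⟨-, i, hi⟩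
  · exact key true (Finset.empty_subset _)
  · obtain ⟨F', hF', hFF', hc⟩ := hK.exists_face (Or.inr hF)
    exact ⟨_, liftFace_mem_unfolding hF' (fun h => hFτ (hFF'.trans h)),
      hl.liftFace_mono hFτ hFF' hF', card_liftFace.trans hc⟩
  · exact key i hi

/-- A triangle of the copy `i` of `τ` lies in that copy and in the lift of exactly one of its two
old cofacets, namely the one labelled `i`. A triangle not over `τ` keeps its two cofacets. -/
theorem isPseudomanifold_unfolding (hK : K.IsPseudomanifold 3) (hτ : K.IsMissingTetrahedron τ)
    (ha : a ∈ τ) (hb : b ∈ τ) (hab : a ≠ b) (hl : FoldLabelling K τ a b l) :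
    (K.unfolding τ a b l hl).IsPseudomanifold 3 := by
  have h4 := hτ.card_eq
  refine isPseudomanifold_of_cofacets (fun G hG => exists_face_unfolding hK hτ hl hG) ?_ (by norm_num)
  intro G hG hc
  by_cases hGτ : G.image Prod.fst ⊆ τ
  · obtain ⟨i, hi⟩ := mem_unfolding_of_subset hG hGτ
    have hGs := eq_image_side_of_subset hi
    set T := G.image Prod.fst with hTdef
    have hTc : T.card = 3 := by
      rw [hGs, Finset.card_image_of_injective _ (side_injective a b i)] at hc
      exact hc
    obtain ⟨r, hr, hTr⟩ := exists_eq_erase h4 hGτ hTc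
    -- A triangle of `τ` omits only one vertex, so it contains `a` or `b`, whose copy records the
    -- side.
    obtain ⟨c, hc', hcr, hcτ⟩ : ∃ c, (c = a ∨ c = b) ∧ r ≠ c ∧ c ∈ τ := by
      by_cases h : r = a
      · exact ⟨b, Or.inr rfl, fun e => hab (h.symm.trans e), hb⟩
      · exact ⟨a, Or.inl rfl, h, ha⟩
    have hcT : c ∈ T := by rw [hTr]; exact Finset.mem_erase.2 ⟨hcr.symm, hcτ⟩
    have hTK : T ∈ K.faces := hτ.mem_faces ⟨c, hcT⟩ hGτ (by rintro e; rw [e] at hTc; omega)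
    obtain ⟨x, y, hxy, hlx, hly, hx, hxK, hall⟩ : ∃ x y, x ≠ y ∧ l c (insert x T) = i ∧
        l c (insert y T) ≠ i ∧ x ∉ τ ∧ insert x T ∈ K.faces ∧
        ∀ z, z ∉ T → insert z T ∈ K.faces → z = x ∨ z = y := by
      obtain ⟨x, y, hxy, hx, hy, hxK, hyK, hall⟩ := hK.exists_cofacets hTK hTc
      rw [hTr] at hx hy hxK hyK
      have hxτ := hτ.notMem_of_insert hr hx hxK
      have hyτ := hτ.notMem_of_insert hr hy hyK
      have hne := hl.cofacet c r x y hc' hr hcr hxτ hyτ hxy hxK hyK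
      rw [← hTr] at hxK hyK hne
      by_cases h : l c (insert x T) = i
      · exact ⟨x, y, hxy, h, fun e => hne (h.trans e.symm), hxτ, hxK, hall⟩
      · refine ⟨y, x, hxy.symm, ?_, h, hyτ, hyK, fun z h1 h2 => (hall z h1 h2).symm⟩
        have aux : ∀ i j k : Bool, j ≠ k → j ≠ i → k = i := by decide
        exact aux _ _ _ hne h
    have hcG : (c, i) ∈ G := by
      rw [hGs]
      refine Finset.mem_image.2 ⟨c, hcT, ?_⟩
      simp [side, hc']
    have hG' : insert (x, false) G = liftFace l (insert x T) := by
      have hxab : ¬ (x = a ∨ x = b) := by rintro (rfl | rfl) <;> contradiction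
      rw [hGs, liftFace, Finset.image_insert]
      congr 1
      · rw [hl.other _ _ (fun e => hxab (Or.inl e)) (fun e => hxab (Or.inr e))]
      · refine Finset.image_congr fun z hz => ?_
        change (z, _) = (z, _)
        rw [hl.label_of_mem hxK (not_insert_subset hx _) hc' (Finset.mem_insert_of_mem hcT)
          (Finset.mem_insert_of_mem hz), hlx]
    refine ⟨side a b i r, (x, false), ?_, ?_, ?_, ?_, ?_, ?_⟩
    · intro e
      have e' : r = x := congrArg Prod.fst e
      exact hx (e' ▸ hr)
    · intro h
      have : r ∈ T := Finset.mem_image_of_mem Prod.fst h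
      rw [hTr] at this
      simp at this
    · intro h
      exact hx (hGτ (Finset.mem_image_of_mem Prod.fst h))
    · exact mem_unfolding_of_subset_sideFace (by simp) (Finset.insert_subset
        (Finset.mem_image_of_mem _ hr) hi)
    · rw [hG']
      exact liftFace_mem_unfolding hxK (not_insert_subset hx _)
    · intro z hz hzK
      by_cases hzτ : z.1 ∈ τ
      · obtain ⟨j, hj⟩ := mem_unfolding_of_subset hzK (by
          rw [Finset.image_insert]; exact Finset.insert_subset hzτ hGτ)
        have hji : i = j := by
          have := (mem_sideFace.1 (hj (Finset.mem_insert_of_mem hcG))).2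
          simpa [hc'] using this
        subst hji
        have hz2 := (mem_sideFace.1 (hj (Finset.mem_insert_self _ _))).2
        have hzr : z.1 = r := by
          by_contra hne
          apply hz
          rw [hGs]
          refine Finset.mem_image.2 ⟨z.1, ?_, Prod.ext rfl hz2.symm⟩
          rw [hTr]
          exact Finset.mem_erase.2 ⟨hne, hzτ⟩
        exact Or.inl (Prod.ext hzr (by rw [hz2, hzr]; rfl))
      · obtain ⟨h1, h2⟩ := mem_link_of_notMem hzτ hzK
        have hzab : ¬ (z.1 = a ∨ z.1 = b) := by
          rintro (e | e) <;> rw [e] at hzτ <;> contradiction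
        have hzm : z ∈ liftFace l (insert z.1 T) := h2 ▸ Finset.mem_insert_self _ _
        have hz2 := (mem_liftFace.1 hzm).2
        rw [hl.other _ _ (fun e => hzab (Or.inl e)) (fun e => hzab (Or.inr e))] at hz2
        rcases hall z.1 (fun h => hzτ (hGτ h)) h1 with e | e
        · exact Or.inr (Prod.ext e hz2)
        -- The cofacet through `y` is labelled differently from `i` at `c`, whereas `(c, i)` lies in
        -- `G`.
        · exfalso
          have hcm : (c, i) ∈ liftFace l (insert z.1 T) := h2 ▸ Finset.mem_insert_of_mem hcG
          have := (mem_liftFace.1 hcm).2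
          rw [e] at this
          exact hly this.symm
  · obtain ⟨hTK, hGT⟩ := mem_unfolding_of_not_subset hG hGτ
    set T := G.image Prod.fst with hTdef
    have hTc : T.card = 3 := by
      rw [hGT, card_liftFace] at hc
      exact hc
    obtain ⟨x, y, hxy, hx, hy, hxK, hyK, hall⟩ := hK.exists_cofacets hTK hTc
    rw [hGT]
    have hnT : ∀ z, z ∉ T → (z, l z (insert z T)) ∉ liftFace l T :=
      fun z hz h => hz (mem_liftFace.1 h).1
    have hin : ∀ z, insert z T ∈ K.faces → insert (z, l z (insert z T)) (liftFace l T) ∈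
        (K.unfolding τ a b l hl).faces := by
      intro z hz
      rw [insert_liftFace hGτ hz hl]
      exact liftFace_mem_unfolding hz (fun h => hGτ ((Finset.subset_insert _ _).trans h))
    refine ⟨_, _, ?_, hnT x hx, hnT y hy, hin x hxK, hin y hyK, ?_⟩
    · exact fun e => hxy (congrArg Prod.fst e)
    · intro z hz hzK
      obtain ⟨h1, h2, h3⟩ := mem_link_liftFace hGτ hz hzK
      rcases hall z.1 h1 h2 with e | e
      · exact Or.inl (Prod.ext e (by rw [h3, e]))
      · exact Or.inr (Prod.ext e (by rw [h3, e]))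

end

end PreAbstractSimplicialComplex

namespace PreAbstractSimplicialComplex

/-! ### Connectedness of the links of the unfolding -/

section LinkReach

variable {W : Type*} [DecidableEq W] {L : PreAbstractSimplicialComplex W} {σ : Finset W} {x y : W}

/-- There is a walk from `x` to `y` in the link of `σ`. -/
def LinkReach (L : PreAbstractSimplicialComplex W) (σ : Finset W) : W → W → Prop :=
  Relation.ReflTransGen fun p q => p ∉ σ ∧ q ∉ σ ∧ insert p (insert q σ) ∈ L.faces

theorem LinkReach.symm (h : L.LinkReach σ x y) : L.LinkReach σ y x := by
  induction h with
  | refl => exact .refl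
  | tail _ h ih => exact ih.head ⟨h.2.1, h.1, by rw [Finset.insert_comm]; exact h.2.2⟩

theorem LinkReach.trans {z : W} (h : L.LinkReach σ x y) (h' : L.LinkReach σ y z) :
    L.LinkReach σ x z :=
  Relation.ReflTransGen.trans h h'

theorem LinkReach.of_subset {F : Finset W} (hF : F ∈ L.faces) (hσ : σ ⊆ F) (hx : x ∉ σ)
    (hy : y ∉ σ) (hxF : x ∈ F) (hyF : y ∈ F) : L.LinkReach σ x y :=
  .single ⟨hx, hy, mem_of_subset hF (Finset.insert_subset hxF (Finset.insert_subset hyF hσ))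
    (by simp)⟩

theorem isConnected_link [Fintype W] (hx : x ∉ σ) (hxL : insert x σ ∈ L.faces)
    (h : ∀ y, y ∉ σ → insert y σ ∈ L.faces → L.LinkReach σ x y) :
    IsConnected (L.link σ).realization := by
  refine isConnected_of_reflTransGen x (singleton_mem_link.2 ⟨hx, hxL⟩) fun y hy => ?_
  obtain ⟨h1, h2⟩ := singleton_mem_link.1 hy
  simpa only [pair_mem_link, LinkReach] using h y h1 h2

end LinkReach

variable {V : Type*} [DecidableEq V] {K : PreAbstractSimplicialComplex V} {τ : Finset V}
  {a b : V} {l : V → Finset V → Bool} {hl : FoldLabelling K τ a b l}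

/-- A step of the walk lies in a face containing `F`, hence not contained in `τ`, and the labels in
it agree with those of the smaller faces; so its lift is again a step. -/
theorem linkReach_liftFace {F : Finset V} (hF : ¬ F ⊆ τ) {x y : V} (h : K.LinkReach F x y) :
    (K.unfolding τ a b l hl).LinkReach (liftFace l F) (x, l x (insert x F))
      (y, l y (insert y F)) := by
  induction h with
  | refl => exact .refl
  | @tail p q _ h ih =>
    have hmono : ∀ z, ¬ insert z F ⊆ τ := fun z h => hF ((Finset.subset_insert _ _).trans h)
    have hp : insert p F ⊆ insert p (insert q F) :=
      Finset.insert_subset_insert _ (Finset.subset_insert _ _)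
    refine ih.trans (LinkReach.of_subset (liftFace_mem_unfolding h.2.2 
      (fun h' => hmono p (hp.trans h'))) (hl.liftFace_mono hF (fun z hz => by simp [hz]) h.2.2) ?_ ?_ ?_ ?_)
    · exact fun h' => h.1 (mem_liftFace.1 h').1
    · exact fun h' => h.2.1 (mem_liftFace.1 h').1
    · exact mem_liftFace.2 ⟨by simp, hl.mono p _ _ (by simp) (hmono p) hp h.2.2⟩
    · exact mem_liftFace.2 ⟨by simp, hl.mono q _ _ (by simp) (hmono q)
        (Finset.subset_insert _ _) h.2.2⟩

/-- Vertices outside `τ` have the single copy `false`, so the walk has only one possible lift.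
Constancy of the labels along inclusions keeps `G` inside each lifted face, and thus the walk stays
on the side of `G`. -/
theorem linkReach_of_linkWalk {G : Finset (V × Bool)} {x p : V}
    (ha : a ∈ τ) (hb : b ∈ τ)
    (hG : insert (x, false) G = liftFace l (insert x (G.image Prod.fst)))
    (hGτ : G.image Prod.fst ⊆ τ)
    (h : K.LinkWalk τ (G.image Prod.fst) x p) :
    (K.unfolding τ a b l hl).LinkReach G (x, false) (p, false) ∧
      insert (p, false) G = liftFace l (insert p (G.image Prod.fst)) := by
  set σ := G.image Prod.fst with hσ
  have hout : ∀ z, z ∉ τ → (z, false) ∉ G := fun z hz h =>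
    hz (hGτ (Finset.mem_image_of_mem Prod.fst h))
  have hzl : ∀ z F, z ∉ τ → l z F = false := fun z F hz =>
    hl.other z F (by rintro rfl; exact hz ha) (by rintro rfl; exact hz hb)
  induction h with
  | refl => exact ⟨.refl, hG⟩
  | @tail p q _ h ih =>
    obtain ⟨ih1, ih2⟩ := ih
    obtain ⟨hp, hq, hpq⟩ := h
    have hpσ : insert p σ ⊆ insert p (insert q σ) :=
      Finset.insert_subset_insert _ (Finset.subset_insert _ _)
    have e1 := hl.liftFace_mono (not_insert_subset hp _) hpσ hpq
    have e2 := hl.liftFace_mono (not_insert_subset hq _) (Finset.subset_insert p _) hpq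
    have hGsub : G ⊆ liftFace l (insert p (insert q σ)) :=
      (Finset.subset_insert _ _).trans (ih2.le.trans e1)
    refine ⟨ih1.trans (LinkReach.of_subset (liftFace_mem_unfolding hpq (not_insert_subset hp _))
      hGsub (hout p hp) (hout q hq) (mem_liftFace.2 ⟨by simp, (hzl _ _ hp).symm⟩)
      (mem_liftFace.2 ⟨by simp, (hzl _ _ hq).symm⟩)), ?_⟩
    have himg : (insert (q, false) G).image Prod.fst = insert q σ := by
      rw [Finset.image_insert]
    have := hl.eq_liftFace_of_subset hpq (G := insert (q, false) G)
      (Finset.insert_subset (mem_liftFace.2 ⟨by simp, (hzl _ _ hq).symm⟩) hGsub) (by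
        rw [himg]; exact not_insert_subset hq _)
    rwa [himg] at this

variable [Fintype V]

/-- In the link of a face over `τ` each vertex is joined to one over `τ`. -/
theorem exists_linkReach_sideFace (hK : K.IsNormalPseudomanifold 3) (hτ : K.IsMissingTetrahedron τ)
    (ha : a ∈ τ) (hb : b ∈ τ) {G : Finset (V × Bool)} (hc : G.card ≤ 2)
    (hGτ : G.image Prod.fst ⊆ τ) {p : V × Bool} (hp : p ∉ G)
    (hpK : insert p G ∈ (K.unfolding τ a b l hl).faces) :
    ∃ q i, (K.unfolding τ a b l hl).LinkReach G p q ∧ q ∉ G ∧ insert q G ⊆ sideFace τ a b i := by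
  have key : ∀ q, q ∉ G → q.1 ∈ τ → insert q G ∈ (K.unfolding τ a b l hl).faces →
      ∃ i, insert q G ⊆ sideFace τ a b i := by
    intro q hq hqτ hqK
    refine mem_unfolding_of_subset hqK ?_
    rw [Finset.image_insert]
    exact Finset.insert_subset hqτ hGτ
  by_cases hpτ : p.1 ∈ τ
  · obtain ⟨i, hi⟩ := key p hp hpτ hpK
    exact ⟨p, i, .refl, hp, hi⟩
  · obtain ⟨h1, h2⟩ := mem_link_of_notMem hpτ hpK
    have hp2 : p = (p.1, false) := by
      refine Prod.ext rfl ?_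
      have : p ∈ liftFace l (insert p.1 (G.image Prod.fst)) := h2 ▸ Finset.mem_insert_self _ _
      rw [(mem_liftFace.1 this).2]
      exact hl.other _ _ (fun e => hpτ (e ▸ ha)) (fun e => hpτ (e ▸ hb))
    obtain ⟨x, y, hwalk, hx, hy, hyG, hxy⟩ := hK.exists_linkWalk_of_mem hτ hGτ
      (Finset.card_image_le.trans hc) hpτ h1
    rw [hp2] at h2 ⊢
    obtain ⟨h3, h4⟩ := linkReach_of_linkWalk (hl := hl) ha hb h2 hGτ hwalk
    have hsub : insert x (G.image Prod.fst) ⊆ insert x (insert y (G.image Prod.fst)) :=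
      Finset.insert_subset_insert _ (Finset.subset_insert _ _)
    have h5 := h4.le.trans (hl.liftFace_mono (not_insert_subset hx _) hsub hxy)
    let q : V × Bool := (y, l y (insert x (insert y (G.image Prod.fst))))
    have hq : q ∉ G := fun h => hyG (Finset.mem_image_of_mem Prod.fst h)
    have hface := liftFace_mem_unfolding (hl := hl) hxy (not_insert_subset hx _)
    have hqf : q ∈ liftFace l (insert x (insert y (G.image Prod.fst))) :=
      mem_liftFace.2 ⟨by simp [q], rfl⟩
    obtain ⟨i, hi⟩ := key q hq hy (mem_of_subset hface
      (Finset.insert_subset hqf ((Finset.subset_insert _ _).trans h5)) (by simp))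
    refine ⟨q, i, h3.trans (LinkReach.of_subset hface ((Finset.subset_insert _ _).trans h5) ?_ hq
      (h5 (Finset.mem_insert_self _ _)) hqf), hq, hi⟩
    exact fun h => hx (hGτ (Finset.mem_image_of_mem Prod.fst h))

/-- The one-sidedness of the curve in the link of `u` joins the two added tetrahedra in the link of
the edge `uv`. -/
theorem linkReach_edge (hK : K.IsNormalPseudomanifold 3) {u v : V}
    (hτ : K.IsMissingTetrahedron {a, b, u, v}) (hl : FoldLabelling K {a, b, u, v} a b l)
    (hu : HasMobiusNeighborhood (K.link {u}).realization
      (simplexBoundary {a, b, v}).realization) :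
    (K.unfolding {a, b, u, v} a b l hl).LinkReach {(u, false), (v, false)} (a, false) (a, true) := by
  classical
  set L := K.unfolding {a, b, u, v} a b l hl with hL
  obtain ⟨hab, hau, hav, hbu, hbv, huv⟩ : a ≠ b ∧ a ≠ u ∧ a ≠ v ∧ b ≠ u ∧ b ≠ v ∧ u ≠ v := by
    have h4 := hτ.card_eq
    -- A coincidence would leave at most three vertices.
    refine ⟨?_, ?_, ?_, ?_, ?_, ?_⟩ <;> rintro rfl <;> revert h4 <;> apply ne_of_lt <;>
      simp only [Finset.mem_insert, Finset.mem_singleton, true_or, or_true,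
        Finset.insert_eq_of_mem] <;>
      exact Finset.card_le_three.trans_lt (by norm_num)
  by_contra hcon
  have hτu : ({a, b, u, v} : Finset V).erase u = {a, b, v} := by
    ext z; simp only [Finset.mem_erase, Finset.mem_insert, Finset.mem_singleton]
    constructor
    · tauto
    · rintro (rfl | rfl | rfl) <;> simp [*, Ne.symm huv]
  have hτv : ({a, b, u, v} : Finset V).erase v = {a, b, u} := by
    ext z; simp only [Finset.mem_erase, Finset.mem_insert, Finset.mem_singleton]
    constructor
    · tauto
    · rintro (rfl | rfl | rfl) <;> simp [*]
  have hnot : ∀ x j, x ≠ u → x ≠ v → ((x, j) : V × Bool) ∉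
      ({(u, false), (v, false)} : Finset (V × Bool)) := by
    intro x j h1 h2
    simp [h1, h2]
  have hface : ∀ G ∈ K.faces, u ∈ G → v ∈ G → ¬ G ⊆ {a, b, u, v} → ∀ x ∈ G, ∀ y ∈ G,
      x ≠ u → x ≠ v → y ≠ u → y ≠ v →
      L.LinkReach {(u, false), (v, false)} (x, l x G) (y, l y G) := by
    intro G hG huG hvG hGτ x hx y hy hxu hxv hyu hyv
    refine LinkReach.of_subset (liftFace_mem_unfolding hG hGτ) ?_ (hnot x _ hxu hxv)
      (hnot y _ hyu hyv) (mem_liftFace.2 ⟨hx, rfl⟩) (mem_liftFace.2 ⟨hy, rfl⟩)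
    refine Finset.insert_subset (mem_liftFace.2 ⟨huG, ?_⟩)
      (Finset.singleton_subset_iff.2 (mem_liftFace.2 ⟨hvG, ?_⟩))
    · exact (hl.other _ _ hau.symm hbu.symm).symm
    · exact (hl.other _ _ hav.symm hbv.symm).symm
  have hside : ∀ i c, c = a ∨ c = b → L.LinkReach {(u, false), (v, false)} (c, i) (a, i) := by
    intro i c hc
    have hcuv : c ≠ u ∧ c ≠ v := by rcases hc with rfl | rfl <;> exact ⟨by assumption, by assumption⟩
    refine LinkReach.of_subset (mem_unfolding_of_subset_sideFace (G := sideFace {a, b, u, v} a b i)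
      ⟨_, Finset.mem_image_of_mem _ (Finset.mem_insert_self a _)⟩ subset_rfl) ?_
      (hnot c i hcuv.1 hcuv.2) (hnot a i hau hav) ?_ ?_
    · refine Finset.insert_subset (mem_sideFace.2 ⟨by simp, ?_⟩)
        (Finset.singleton_subset_iff.2 (mem_sideFace.2 ⟨by simp, ?_⟩))
      · simp [hau.symm, hbu.symm]
      · simp [hav.symm, hbv.symm]
    · refine mem_sideFace.2 ⟨?_, by simp [hc]⟩
      rcases hc with rfl | rfl <;> simp
    · exact mem_sideFace.2 ⟨by simp, by simp⟩
  let P : Finset V → Prop := fun F => ∃ x ∈ F, x ≠ u ∧ x ≠ v ∧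
    L.LinkReach {(u, false), (v, false)} (x, l x F) (a, true)
  -- If the two copies of `a` were not joined in the link of uv, this would label both sides along
  -- the whole curve: faces through `v` by the component of the link of uv that they meet, other
  -- faces by their side at `a` or `b`.
  let μ : Finset V → Bool := fun F =>
    if v ∈ F then decide (P F) else if a ∈ F then l a F else l b F
  have hμv : ∀ F, v ∈ F → μ F = decide (P F) := fun F h => if_pos h
  have hμa : ∀ F, F ∈ K.faces → ¬ F ⊆ {a, b, u, v} → v ∉ F → ∀ c, c = a ∨ c = b → c ∈ F →
      μ F = l c F := by
    intro F hF hFτ hv c hc hcF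
    simp only [μ, if_neg hv]
    rcases hc with rfl | rfl
    · rw [if_pos hcF]
    · split_ifs with haF
      · exact hl.agree F hF haF hcF hFτ
      · rfl
  have hμ : ∀ F G, u ∈ F → (∃ d ∈ ({a, b, u, v} : Finset V).erase u, d ∈ F) →
      ¬ F ⊆ {a, b, u, v} → F ⊆ G → G ∈ K.faces → μ F = μ G := by
    rintro F G huF ⟨d, hd, hdF⟩ hFτ hFG hG
    have hF : F ∈ K.faces := mem_of_subset hG hFG ⟨u, huF⟩
    have hGτ : ¬ G ⊆ {a, b, u, v} := fun h => hFτ (hFG.trans h)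
    have hlab : ∀ x ∈ F, l x F = l x G := fun x hx => hl.mono x F G hx hFτ hFG hG
    by_cases hvF : v ∈ F
    · rw [hμv F hvF, hμv G (hFG hvF)]
      congr 1
      rw [eq_iff_iff]
      constructor
      · rintro ⟨x, hx, h1, h2, h3⟩
        exact ⟨x, hFG hx, h1, h2, hlab x hx ▸ h3⟩
      · rintro ⟨x, hx, h1, h2, h3⟩
        obtain ⟨z, hzF, hz⟩ := Finset.not_subset.1 hFτ
        have hzu : z ≠ u := by rintro rfl; simp at hz
        have hzv : z ≠ v := by rintro rfl; simp at hz
        refine ⟨z, hzF, hzu, hzv, ?_⟩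
        rw [hlab z hzF]
        exact (hface G hG (hFG huF) (hFG hvF) hGτ z (hFG hzF) x hx hzu hzv h1 h2).trans h3
    · have hd' : d = a ∨ d = b := by
        rw [hτu] at hd
        simp only [Finset.mem_insert, Finset.mem_singleton] at hd
        rcases hd with h | h | h
        · exact Or.inl h
        · exact Or.inr h
        · exact absurd (h ▸ hdF) hvF
      have hduv : d ≠ u ∧ d ≠ v := by
        rcases hd' with rfl | rfl <;> exact ⟨by assumption, by assumption⟩
      rw [hμa F hF hFτ hvF d hd' hdF, hlab d hdF]
      by_cases hvG : v ∈ G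
      · rw [hμv G hvG]
        cases hi : l d G with
        | true =>
          symm
          rw [decide_eq_true_iff]
          exact ⟨d, hFG hdF, hduv.1, hduv.2, by rw [hi]; exact hside true d hd'⟩
        | false =>
          symm
          rw [decide_eq_false_iff_not]
          rintro ⟨x, hx, h1, h2, h3⟩
          -- A face through `v` labelled `false` at `d` that also meets the component of `(a, true)`
          -- would join the two copies of `a`.
          apply hcon
          have := hface G hG (hFG huF) hvG hGτ d (hFG hdF) x hx hduv.1 hduv.2 h1 h2
          rw [hi] at this
          exact ((hside false d hd').symm.trans this).trans h3
      · rw [hμa G hG hGτ hvG d hd' (hFG hdF)]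
  -- The two cofacets of the triangle `abu` have opposite labels at `a`, whereas one-sidedness makes
  -- `μ` equal on them.
  obtain ⟨x, y, hxy, hx, hy, hxK, hyK, -⟩ := hK.exists_cofacets
    (T := ({a, b, u, v} : Finset V).erase v)
    (hτ.mem_faces ⟨a, by rw [hτv]; simp⟩ (Finset.erase_subset _ _)
      (fun h => Finset.notMem_erase v _ (h.symm ▸ (by simp : v ∈ ({a, b, u, v} : Finset V)))))
    (by rw [Finset.card_erase_of_mem (by simp), hτ.card_eq])
  have hxτ := hτ.notMem_of_insert (by simp) hx hxK
  have hyτ := hτ.notMem_of_insert (by simp) hy hyK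
  have hne := hl.cofacet a v x y (Or.inl rfl) (by simp) hav.symm hxτ hyτ hxy hxK hyK
  have hv : ∀ z, z ∉ ({a, b, u, v} : Finset V) →
      v ∉ insert z (({a, b, u, v} : Finset V).erase v) := by
    intro z hz h
    rcases Finset.mem_insert.1 h with h | h
    · rw [← h] at hz; simp at hz
    · exact Finset.notMem_erase _ _ h
  have haz : ∀ z, a ∈ insert z (({a, b, u, v} : Finset V).erase v) := fun z => by
    rw [hτv]; simp
  have huz : ∀ z, u ∈ insert z (({a, b, u, v} : Finset V).erase v) := fun z => by
    rw [hτv]; simp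
  rw [← hτu] at hu
  have := hτ.label_eq_of_mobius (c := a) (by simp) (by rw [hτu]; simp) hu hμ
    hxK (huz x) (haz x) (not_insert_subset hxτ _) hyK (huz y) (haz y) (not_insert_subset hyτ _)
  rw [hμa _ hxK (not_insert_subset hxτ _) (hv x hxτ) a (Or.inl rfl) (haz x),
    hμa _ hyK (not_insert_subset hyτ _) (hv y hyτ) a (Or.inl rfl) (haz y)] at this
  exact hne this

end PreAbstractSimplicialComplex

/-! ### Normality of the unfolding -/

namespace PreAbstractSimplicialComplex

variable {V : Type*} [DecidableEq V] {K : PreAbstractSimplicialComplex V}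
  {a b u v : V} {l : V → Finset V → Bool}

/-- Over `τ`, every vertex of the link can be walked into a copy of `τ`, so it remains to join the
two copies when both contain `G`. They share u and v, hence only the link of the edge uv needs the
Möbius strip. Away from `τ`, links are lifted from `K`. -/
theorem isNormalPseudomanifold_unfolding [Fintype V] (hK : K.IsNormalPseudomanifold 3)
    (hτ : K.IsMissingTetrahedron {a, b, u, v}) (hab : a ≠ b)
    (hl : FoldLabelling K {a, b, u, v} a b l)
    (hu : HasMobiusNeighborhood (K.link {u}).realization
      (simplexBoundary {a, b, v}).realization) :
    (K.unfolding {a, b, u, v} a b l hl).IsNormalPseudomanifold 3 where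
  toIsPseudomanifold := isPseudomanifold_unfolding hK.toIsPseudomanifold hτ (by simp) (by simp) hab hl
  connected_link := by
    intro G hG hc
    have h4 := hτ.card_eq
    have hedge := linkReach_edge hK hτ hl hu
    set τ : Finset V := {a, b, u, v} with hτdef
    by_cases hGτ : G.image Prod.fst ⊆ τ
    · obtain ⟨i, hi⟩ : ∃ i, G ⊆ sideFace τ a b i := by
        rcases hG with rfl | hG
        · exact ⟨true, Finset.empty_subset _⟩
        · exact mem_unfolding_of_subset hG hGτ
      have hsideK : ∀ j, sideFace τ a b j ∈ (K.unfolding τ a b l hl).faces := fun j =>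
        mem_unfolding_of_subset_sideFace
          (by rw [← Finset.card_pos, card_sideFace, h4]; norm_num) subset_rfl
      obtain ⟨w, hwi, hwG⟩ : ∃ w ∈ sideFace τ a b i, w ∉ G := by
        by_contra! h
        have := Finset.card_le_card (s := sideFace τ a b i) (t := G) h
        rw [card_sideFace] at this
        omega
      refine isConnected_link hwG (mem_of_subset (hsideK i) (Finset.insert_subset hwi hi)
        (by simp)) fun y hy hyK => ?_
      obtain ⟨q, j, hyq, hq, hqj⟩ := exists_linkReach_sideFace hK hτ (by simp [hτdef])
        (by simp [hτdef]) (by omega) hGτ hy hyK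
      refine LinkReach.trans ?_ hyq.symm
      have hqm := hqj (Finset.mem_insert_self _ _)
      have hGj : G ⊆ sideFace τ a b j := (Finset.subset_insert _ _).trans hqj
      by_cases hij : i = j
      · subst hij
        exact .of_subset (hsideK i) hi hwG hq hwi hqm
      · have via : ∀ r s, r ∉ G → s ∉ G → r ∈ sideFace τ a b i → s ∈ sideFace τ a b j →
            (K.unfolding τ a b l hl).LinkReach G r s →
            (K.unfolding τ a b l hl).LinkReach G w q := fun r s h1 h2 h3 h5 h6 =>
          ((LinkReach.of_subset (hsideK i) hi hwG h1 hwi h3).trans h6).trans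
            (.of_subset (hsideK j) hGj h2 hq h5 hqm)
        -- A face in both copies contains no copy of `a` or `b`, since these differ between the
        -- copies.
        have hGab : ∀ p ∈ G, ¬ (p.1 = a ∨ p.1 = b) := by
          intro p hp h
          have h1 := (mem_sideFace.1 (hi hp)).2
          have h2 := (mem_sideFace.1 (hGj hp)).2
          rw [if_pos h] at h1 h2
          exact hij (h1.symm.trans h2)
        have hmem : ∀ x ∈ τ, ¬ (x = a ∨ x = b) → ∀ j, (x, false) ∈ sideFace τ a b j :=
          fun x hx h j => mem_sideFace.2 ⟨hx, (if_neg h).symm⟩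
        by_cases hex : ∃ x ∈ τ, ¬ (x = a ∨ x = b) ∧ (x, false) ∉ G
        · obtain ⟨x, hx, hxab, hxG⟩ := hex
          exact via _ _ hxG hxG (hmem x hx hxab i) (hmem x hx hxab j) .refl
        · push Not at hex
          obtain ⟨hau, hav, hbu, hbv⟩ : a ≠ u ∧ a ≠ v ∧ b ≠ u ∧ b ≠ v := by
            refine ⟨?_, ?_, ?_, ?_⟩ <;> rintro rfl <;> revert h4 <;> apply ne_of_lt <;>
              simp only [hτdef, Finset.mem_insert, Finset.mem_singleton, true_or, or_true,
                Finset.insert_eq_of_mem] <;>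
              exact Finset.card_le_three.trans_lt (by norm_num)
          have hGe : G = {(u, false), (v, false)} := by
            apply Finset.Subset.antisymm
            · intro p hp
              have hpab := hGab p hp
              obtain ⟨h1, h2⟩ := mem_sideFace.1 (hi hp)
              rw [if_neg hpab] at h2
              rw [not_or] at hpab
              simp only [hτdef, Finset.mem_insert, Finset.mem_singleton, hpab.1, hpab.2,
                false_or] at h1
              simp only [Finset.mem_insert, Finset.mem_singleton]
              exact h1.imp (fun h => Prod.ext h h2) (fun h => Prod.ext h h2)
            · refine Finset.insert_subset (hex u (by simp [hτdef]) ⟨hau.symm, hbu.symm⟩)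
                (Finset.singleton_subset_iff.2 (hex v (by simp [hτdef]) ⟨hav.symm, hbv.symm⟩))
          have haG : ∀ k, (a, k) ∉ G := fun k h => hGab _ h (Or.inl rfl)
          have ham : ∀ k, (a, k) ∈ sideFace τ a b k := fun k =>
            mem_sideFace.2 ⟨by simp [hτdef], by simp⟩
          refine via (a, i) (a, j) (haG i) (haG j) (ham i) (ham j) ?_
          rw [hGe]
          cases i <;> cases j
          · exact absurd rfl hij
          · exact hedge
          · exact hedge.symm
          · exact absurd rfl hij
    · have hG' : G ∈ (K.unfolding τ a b l hl).faces :=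
        hG.resolve_left (by rintro rfl; simp at hGτ)
      obtain ⟨hFK, hGF⟩ := mem_unfolding_of_not_subset hG' hGτ
      generalize G.image Prod.fst = F at *
      subst hGF
      rw [card_liftFace] at hc
      obtain ⟨H, hH, hFH, hHc⟩ := hK.exists_face (Or.inr hFK)
      obtain ⟨x, hxH, hxF⟩ : ∃ x ∈ H, x ∉ F := by
        by_contra! h
        have := Finset.card_le_card (s := H) (t := F) h
        omega
      have hxK : insert x F ∈ K.faces := mem_of_subset hH (Finset.insert_subset hxH hFH) (by simp)
      refine isConnected_link (x := (x, l x (insert x F))) (fun h => hxF (mem_liftFace.1 h).1) ?_ ?_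
      · rw [insert_liftFace hGτ hxK hl]
        exact liftFace_mem_unfolding hxK fun h => hGτ ((Finset.subset_insert _ _).trans h)
      · intro y hy hyK
        obtain ⟨h1, h2, h3⟩ := mem_link_liftFace hGτ hy hyK
        have := linkReach_liftFace (hl := hl) hGτ (hK.walk_link hc hxF hxK h1 h2)
        rwa [← h3] at this

/-! ### Folding the unfolding -/

/-- The bijection between the two copies of `τ`. -/
def sideEquiv (τ : Finset V) (a b : V) : sideFace τ a b true ≃ sideFace τ a b false where
  toFun p := ⟨side a b false p.1.1, Finset.mem_image_of_mem _ (mem_sideFace.1 p.2).1⟩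
  invFun p := ⟨side a b true p.1.1, Finset.mem_image_of_mem _ (mem_sideFace.1 p.2).1⟩
  left_inv p := Subtype.ext (Prod.ext rfl (mem_sideFace.1 p.2).2.symm)
  right_inv p := Subtype.ext (Prod.ext rfl (mem_sideFace.1 p.2).2.symm)

theorem _root_.SimpleGraph.Walk.exists_mem_support_of_length_le_two {W : Type*}
    {G : SimpleGraph W} {x y : W} (hne : x ≠ y) (hadj : ¬ G.Adj x y) (p : G.Walk x y)
    (hp : p.length ≤ 2) : ∃ z ∈ p.support, G.Adj x z ∧ G.Adj z y := by
  match p, hp with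
  | .nil, _ => exact absurd rfl hne
  | .cons h .nil, _ => exact absurd h hadj
  | .cons h (.cons h' .nil), _ => exact ⟨_, by simp, h, h'⟩
  | .cons h (.cons h' (.cons h'' q)), hp =>
    simp only [SimpleGraph.Walk.length_cons] at hp
    omega

variable {τ : Finset V} {hl : FoldLabelling K τ a b l}

/-- In particular the two copies of `a`, or of `b`, are not adjacent, which excludes paths of length
one in admissibility. -/
theorem eq_of_fst_eq {G : Finset (V × Bool)} (hG : G ∈ (K.unfolding τ a b l hl).faces)
    {p q : V × Bool} (hp : p ∈ G) (hq : q ∈ G) (h : p.1 = q.1) : p = q := by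
  rcases hG with ⟨F, -, -, rfl⟩ | ⟨-, i, hi⟩
  · exact Prod.ext h (by rw [(mem_liftFace.1 hp).2, (mem_liftFace.1 hq).2, h])
  · exact Prod.ext h (by rw [(mem_sideFace.1 (hi hp)).2, (mem_sideFace.1 (hi hq)).2, h])

/-- The two copies of `a` (or of `b`) have no common neighbours but `u` and `v`. -/
theorem mem_inter_of_pair_mem {c : V} (hc : c = a ∨ c = b) (hcτ : c ∈ τ) {z : V × Bool}
    (h₁ : {(c, true), z} ∈ (K.unfolding τ a b l hl).faces)
    (h₂ : {z, (c, false)} ∈ (K.unfolding τ a b l hl).faces) :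
    z ∈ sideFace τ a b true ∩ sideFace τ a b false := by
  by_cases hz : z.1 ∈ τ
  · obtain ⟨i, hi⟩ := mem_unfolding_of_subset h₁ (by
      simp [Finset.image_insert, Finset.insert_subset_iff, hz, hcτ])
    obtain ⟨j, hj⟩ := mem_unfolding_of_subset h₂ (by
      simp [Finset.image_insert, Finset.insert_subset_iff, hz, hcτ])
    have h1 := (mem_sideFace.1 (hi (Finset.mem_insert_self _ _))).2
    have h2 := (mem_sideFace.1 (hj (Finset.mem_insert_of_mem (Finset.mem_singleton_self _)))).2
    simp only [hc, if_true] at h1 h2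
    subst h1 h2
    exact Finset.mem_inter.2 ⟨hi (by simp), hj (by simp)⟩
  -- The edge from `c` to the vertex under `z` leaves `τ`, so it has a single label at `c` and
  -- cannot be lifted to both copies of `c`.
  · exfalso
    obtain ⟨-, h1⟩ := mem_unfolding_of_not_subset h₁ (fun h => hz (h (by simp)))
    obtain ⟨-, h2⟩ := mem_unfolding_of_not_subset h₂ (fun h => hz (h (by simp)))
    have h3 : ((c, true) : V × Bool) ∈ ({(c, true), z} : Finset (V × Bool)) := by simp
    have h4 : ((c, false) : V × Bool) ∈ ({z, (c, false)} : Finset (V × Bool)) := by simp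
    rw [h1] at h3
    rw [h2] at h4
    have h5 := (mem_liftFace.1 h3).2
    have h6 := (mem_liftFace.1 h4).2
    simp only [Finset.image_insert, Finset.image_singleton] at h5 h6
    rw [Finset.pair_comm, ← h5] at h6
    exact absurd h6 (by decide)

/-- On vertices the identification forgets the side: the representative is the `true` copy over `a`
and `b`, and all other vertices have one copy only. Hence the projection to `V` inverts the
unfolding. -/
theorem foldMap_sideEquiv {p : V × Bool} (ha : a ∈ τ) (hb : b ∈ τ)
    (hp : {p} ∈ (K.unfolding τ a b l hl).faces) :
    foldMap _ _ (sideEquiv τ a b) p = side a b true p.1 := by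
  unfold foldMap
  split_ifs with h
  · rfl
  · by_cases hpτ : p.1 ∈ τ
    · obtain ⟨i, hi⟩ := mem_unfolding_of_subset hp (by simpa using hpτ)
      have hpi := hi (Finset.mem_singleton_self _)
      cases i
      · exact absurd hpi h
      · exact Prod.ext rfl (mem_sideFace.1 hpi).2
    · obtain ⟨-, h1⟩ := mem_unfolding_of_not_subset hp (by simpa using hpτ)
      have h2 : p ∈ ({p} : Finset (V × Bool)) := by simp
      rw [h1] at h2
      have hn : ¬ (p.1 = a ∨ p.1 = b) := by
        rintro (e | e)
        · exact hpτ (e ▸ ha)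
        · exact hpτ (e ▸ hb)
      refine Prod.ext rfl ?_
      rw [(mem_liftFace.1 h2).2]
      simp only [side, if_neg hn]
      exact hl.other _ _ (fun e => hn (Or.inl e)) (fun e => hn (Or.inr e))

theorem image_foldMap_sideEquiv {G : Finset (V × Bool)} (ha : a ∈ τ) (hb : b ∈ τ)
    (hG : G ∈ (K.unfolding τ a b l hl).faces) :
    G.image (foldMap _ _ (sideEquiv τ a b)) = (G.image Prod.fst).image (side a b true) := by
  rw [Finset.image_image]
  refine Finset.image_congr fun p hp => ?_
  exact foldMap_sideEquiv ha hb (mem_of_subset hG (Finset.singleton_subset_iff.2 hp) (by simp))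

theorem image_fst_image_side {F : Finset V} {i : Bool} :
    (F.image (side a b i)).image Prod.fst = F :=
  image_fst_sideFace

theorem isIsoVia_edgeFolding {u' v' : V × Bool} (hτ : K.IsMissingTetrahedron τ) (ha : a ∈ τ)
    (hb : b ∈ τ)
    (hψ : (K.unfolding τ a b l hl).EdgeFoldingAdmissible u' v' _ _ (sideEquiv τ a b)) :
    ((K.unfolding τ a b l hl).edgeFolding hψ).IsIsoVia K Prod.fst := by
  constructor
  · have key : ∀ p ∈ ((K.unfolding τ a b l hl).edgeFolding hψ).vertexSet,
        p = side a b true p.1 := by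
      rintro p ⟨⟨G, hG, hGp⟩, -⟩
      change G.image _ = {p} at hGp
      rw [image_foldMap_sideEquiv ha hb hG] at hGp
      have hp : p ∈ ({p} : Finset (V × Bool)) := by simp
      rw [← hGp] at hp
      obtain ⟨x, -, rfl⟩ := Finset.mem_image.1 hp
      rfl
    intro p hp q hq hpq
    rw [key p hp, key q hq, hpq]
  · ext F
    constructor
    · rintro ⟨_, ⟨⟨G, hG, rfl⟩, hne⟩, rfl⟩
      change (G.image _).image Prod.fst ∈ K.faces
      change G.image _ ≠ sideFace τ a b true at hne
      rw [image_foldMap_sideEquiv ha hb hG] at hne ⊢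
      rw [image_fst_image_side]
      by_cases hGτ : G.image Prod.fst ⊆ τ
      · refine hτ.mem_faces (((unfolding K τ a b l hl).isRelLowerSet_faces hG).1.image _) hGτ ?_
        intro h
        rw [h] at hne
        exact hne rfl
      · exact (mem_unfolding_of_not_subset hG hGτ).1
    · intro hF
      have key : ∀ G, G ∈ (K.unfolding τ a b l hl).faces → G.image Prod.fst = F →
          F ∈ (((K.unfolding τ a b l hl).edgeFolding hψ).map Prod.fst).faces := by
        intro G hG hGF
        have himg := image_foldMap_sideEquiv ha hb hG
        rw [hGF] at himg
        -- The representative of `F` could be the removed facet only if `F = τ`, which is not a face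
        -- of `K`.
        refine ⟨F.image (side a b true), ⟨⟨G, hG, himg⟩, fun h => ?_⟩, image_fst_image_side⟩
        have : F = τ := by
          have h' : F.image (side a b true) = sideFace τ a b true := h
          rw [← image_fst_image_side (a := a) (b := b) (i := true) (F := F), h',
            image_fst_sideFace]
        exact hτ.notMem (this ▸ hF)
      by_cases hFτ : F ⊆ τ
      · exact key (F.image (side a b true)) (mem_unfolding_of_subset_sideFace
          ((K.isRelLowerSet_faces hF).1.image _) (Finset.image_subset_image hFτ))
          image_fst_image_side
      · exact key _ (liftFace_mem_unfolding hF hFτ) image_fst_liftFace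

theorem edgeFoldingAdmissible_sideEquiv [Fintype V] {hl : FoldLabelling K {a, b, u, v} a b l}
    (hL : (K.unfolding {a, b, u, v} a b l hl).IsPseudomanifold 3)
    (h4 : ({a, b, u, v} : Finset V).card = 4) :
    (K.unfolding {a, b, u, v} a b l hl).EdgeFoldingAdmissible (u, false) (v, false) _ _
      (sideEquiv {a, b, u, v} a b) := by
  obtain ⟨hau, hav, hbu, hbv, huv⟩ : a ≠ u ∧ a ≠ v ∧ b ≠ u ∧ b ≠ v ∧ u ≠ v := by
    refine ⟨?_, ?_, ?_, ?_, ?_⟩ <;> rintro rfl <;> revert h4 <;> apply ne_of_lt <;>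
      simp only [Finset.mem_insert, Finset.mem_singleton, true_or, or_true,
        Finset.insert_eq_of_mem] <;>
      exact Finset.card_le_three.trans_lt (by norm_num)
  have hfacet : ∀ i, (K.unfolding {a, b, u, v} a b l hl).IsFacet (sideFace {a, b, u, v} a b i) :=
    fun i => hL.isFacet_iff.2 ⟨mem_unfolding_of_subset_sideFace
      (by rw [← Finset.card_pos, card_sideFace, h4]; norm_num) subset_rfl, card_sideFace.trans h4⟩
  have hinter : sideFace {a, b, u, v} a b true ∩ sideFace {a, b, u, v} a b false =
      {(u, false), (v, false)} := by
    ext ⟨x, j⟩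
    simp only [Finset.mem_inter, mem_sideFace, Finset.mem_insert, Finset.mem_singleton,
      Prod.mk.injEq]
    constructor
    · rintro ⟨⟨h1, h2⟩, -, h3⟩
      by_cases h : x = a ∨ x = b
      · rw [if_pos h] at h2 h3
        exact absurd (h2.symm.trans h3) (by decide)
      · rw [if_neg h] at h2
        rw [not_or] at h
        simp only [h.1, h.2, false_or] at h1
        exact h1.imp (fun e => ⟨e, h2⟩) (fun e => ⟨e, h2⟩)
    · rintro (⟨rfl, rfl⟩ | ⟨rfl, rfl⟩) <;> simp [*, Ne.symm hau, Ne.symm hav, Ne.symm hbu, Ne.symm hbv]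
  refine ⟨hfacet true, hfacet false, fun h => huv (congrArg Prod.fst h), hinter, ?_, ?_, ?_⟩
  · exact fun _ => Prod.ext rfl (if_neg (by simp [hau.symm, hbu.symm]))
  · exact fun _ => Prod.ext rfl (if_neg (by simp [hav.symm, hbv.symm]))
  · intro y hyu hyv p hp
    obtain ⟨h1, h2⟩ := mem_sideFace.1 y.2
    have hc : (y : V × Bool).1 = a ∨ (y : V × Bool).1 = b := by
      by_contra h
      rw [if_neg h] at h2
      rw [not_or] at h
      simp only [Finset.mem_insert, Finset.mem_singleton, h.1, h.2, false_or] at h1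
      rcases h1 with e | e
      · exact hyu (Prod.ext e h2)
      · exact hyv (Prod.ext e h2)
    have hy : (y : V × Bool) = ((y : V × Bool).1, true) := Prod.ext rfl (by rw [h2, if_pos hc])
    have hψy : ((sideEquiv {a, b, u, v} a b y : _) : V × Bool) = ((y : V × Bool).1, false) :=
      Prod.ext rfl (if_pos hc)
    have hne : (y : V × Bool) ≠ (sideEquiv {a, b, u, v} a b y : _) := by
      rw [hψy]
      intro h
      rw [h] at hy
      exact absurd (congrArg Prod.snd hy) (by simp)
    have hadj : ¬ (K.unfolding {a, b, u, v} a b l hl).graph.Adj (y : V × Bool)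
        (sideEquiv {a, b, u, v} a b y : _) := fun h =>
      hne (eq_of_fst_eq (hl := hl) h.2 (by simp) (by simp) (by rw [hψy]))
    obtain ⟨z, hz, hz1, hz2⟩ := SimpleGraph.Walk.exists_mem_support_of_length_le_two hne hadj p hp
    have hz1 := hz1.2
    have hz2 := hz2.2
    rw [hy] at hz1
    rw [hψy] at hz2
    have := mem_inter_of_pair_mem hc h1 hz1 hz2
    rw [hinter] at this
    simp only [Finset.mem_insert, Finset.mem_singleton] at this
    rcases this with rfl | rfl
    · exact Or.inl hz
    · exact Or.inr hz

end PreAbstractSimplicialComplex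

theorem mainTheorem10 {V : Type w} [Fintype V] [DecidableEq V]
    (Δ : PreAbstractSimplicialComplex V) (hΔ : Δ.IsNormalPseudomanifold 3)
    (a b u v : V)
    (hτ : Δ.IsMissingTetrahedron {a, b, u, v})
    (ha : Δ.SeparatesLink {b, u, v} a)
    (hb : Δ.SeparatesLink {a, u, v} b)
    (hu : HasMobiusNeighborhood (Δ.link {u}).realization
      (PreAbstractSimplicialComplex.simplexBoundary {a, b, v}).realization) :
    ∃ (V' : Type w) (_ : Fintype V') (_ : DecidableEq V')
      (Δ' : PreAbstractSimplicialComplex V') (u' v' : V') (σ₁ σ₂ : Finset V') (ψ : σ₁ ≃ σ₂)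
      (hψ : Δ'.EdgeFoldingAdmissible u' v' σ₁ σ₂ ψ) (f : V' → V),
      Δ'.IsNormalPseudomanifold 3 ∧
      (Δ'.edgeFolding hψ).IsIsoVia Δ f ∧
      f u' = u ∧ f v' = v ∧ σ₁.image f = {a, b, u, v} := by
  have h4 := hτ.card_eq
  obtain ⟨hab, hau, hav, hbu, hbv⟩ : a ≠ b ∧ a ≠ u ∧ a ≠ v ∧ b ≠ u ∧ b ≠ v := by
    refine ⟨?_, ?_, ?_, ?_, ?_⟩ <;> rintro rfl <;> revert h4 <;> apply ne_of_lt <;>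
      simp only [Finset.mem_insert, Finset.mem_singleton, true_or, or_true,
        Finset.insert_eq_of_mem] <;>
      exact Finset.card_le_three.trans_lt (by norm_num)
  have hea : ({a, b, u, v} : Finset V).erase a = {b, u, v} :=
    Finset.erase_insert (by simp [hab, hau, hav])
  have heb : ({a, b, u, v} : Finset V).erase b = {a, u, v} := by
    rw [Finset.insert_comm]
    exact Finset.erase_insert (by simp [hab.symm, hbu, hbv])
  rw [← hea] at ha
  rw [← heb] at hb
  obtain ⟨l, hl⟩ := hΔ.exists_foldLabelling hτ (by simp) (by simp) hab ha hb
  have hN := PreAbstractSimplicialComplex.isNormalPseudomanifold_unfolding hΔ hτ hab hl hu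
  have hψ := PreAbstractSimplicialComplex.edgeFoldingAdmissible_sideEquiv hN.toIsPseudomanifold h4
  exact ⟨V × Bool, inferInstance, inferInstance, _, _, _, _, _, _, hψ, Prod.fst, hN,
    PreAbstractSimplicialComplex.isIsoVia_edgeFolding hτ (by simp) (by simp) hψ, rfl, rfl,
    PreAbstractSimplicialComplex.image_fst_sideFace⟩
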